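/- Theorem (compactness for weak $\Sigma$-convergence along a flow). Setting. Let $d\in\mathbb N$, $T>0$. (1) Let $\mathcal A$ be an algebra with mean value on $\mathbb R$: a norm-closed subalgebra of the algebra $\mathrm{BUC}(\mathbb R)$ of bounded uniformly continuous functions $\mathbb R\to\mathbb C$, closed under complex conjugation, containing the constants, invariant under all translations $f\mapsto f(\cdot-a)$, $a\in\mathbb R$, and such that every $f\in\mathcal A$ has a mean value $M(f)\in\mathbb C$, i.e. $f(\cdot/\varepsilon)\rightharpoonup M(f)$ weakly-$*$ in $L^\infty(\mathbb R)$ as $\varepsilon\to0$. Let $\Delta(\mathcal A)$ be the spectrum of $\mathcal A$ (the compact Hausdorff space of unital characters $s:\mathcal A\to\mathbb C$ with the weak-$*$ topology), let $\widehat f(s)=s(f)$ be the Gelfand transform, and let $\beta$ be the Radon probability measure on $\Delta(\mathcal A)$ with $M(f)=\int_{\Delta(\mathcal A)}\widehat f\,d\beta$ for all $f\in\mathcal A$. Let $\mathbb T^d=\mathbb R^d/\mathbb Z^d$ with its normalized Lebesgue measure, and let $\mathcal A\odot C(\mathbb T^d)$ be the closure, in the supremum norm on $\mathbb R\times\mathbb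 T^d$, of the linear span of the products $f(\tau)g(y)$ with $f\in\mathcal A$, $g\in C(\mathbb T^d)$. For $F\in\mathcal A\odot C(\mathbb T^d)$ put $\widehat F(s,y)=s(F(\cdot,y))$. (2) Let $\Phi:\mathbb R\times\mathbb R^d\to\mathbb R^d$, $(\tau,x)\mapsto\Phi_\tau(x)$, be of class $C^1$ with $\Phi_t(\Phi_s(x))=\Phi_{t+s}(x)$ for all $t,s,x$. Let $J(\tau,x)$ be the Jacobian matrix at $x$ of $\Phi_{-\tau}$, and assume that $\det J(\tau,x)=1$ for all $\tau,x$ and that $\sup_{x\in K}\sup_{\tau\in\mathbb R}|J(\tau,x)|<\infty$ for every compact $K\subset\mathbb R^d$. (3) A test function is a map $\psi:(0,T)\times\mathbb R^d\to\mathcal A\odot C(\mathbb T^d)$ that is $C^\infty$ as a map into this Banach space and whose norm is square-integrable on $(0,T)\times\mathbb R^d$; write $\psi(t,X,\tau,y)$ for the value of $\psi(t,X)$ at $(\tau,y)$, regarded as $\mathbb Z^d$-periodic in $y$. Given positive $\varepsilon_n\to0$, a sequence $u^{\varepsilon_n}\in L^2((0,T)\times\mathbb R^d)$ weakly $\Sigma$-converges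 along $\Phi_\tau$ to $u_0\in L^2((0,T)\times\mathbb R^d\times\Delta(\mathcal A)\times\mathbb T^d)$ (with respect to the measure $dt\,dX\,d\beta(s)\,dy$) if for every test function $\psi$ $$\lim_{n\to\infty}\iint_{(0,T)\times\mathbb R^d}u^{\varepsilon_n}(t,x)\,\psi\Big(t,\Phi_{-t/\varepsilon_n}(x),\frac t{\varepsilon_n},\frac x{\varepsilon_n}\Big)\,dx\,dt=\iiiint_{(0,T)\times\mathbb R^d\times\Delta(\mathcal A)\times\mathbb T^d}u_0(t,X,s,y)\,\widehat\psi(t,X,s,y)\,dy\,d\beta(s)\,dX\,dt .$$ Claim. Let $\varepsilon_n>0$, $\varepsilon_n\to0$, and let $(u^{\varepsilon_n})_{n\in\mathbb N}$ be a bounded sequence of complex-valued functions in $L^2((0,T)\times\mathbb R^d)$. Then there are a subsequence $(\varepsilon_{n_k})_k$ and a function $u_0\in L^2((0,T)\times\mathbb R^d\times\Delta(\mathcal A)\times\mathbb T^d)$ such that $u^{\varepsilon_{n_k}}$ weakly $\Sigma$-converges along $\Phi_\tau$ to $u_0$ as $k\to\infty$. -/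

import Mathlib

open MeasureTheory Filter Topology Set
open scoped BoundedContinuousFunction ContDiff

noncomputable section

/-- `HasMeanValue f m`: the functions `f (· / ε)` converge to the constant `m` weakly-* in
`L^∞(ℝ)` as `ε → 0`, that is, when tested against every `g ∈ L¹(ℝ)`. -/
def HasMeanValue (f : ℝ → ℂ) (m : ℂ) : Prop :=
  ∀ g : ℝ → ℂ, Integrable g volume →
    Tendsto (fun ε : ℝ => ∫ t, f (t / ε) * g t) (𝓝[>] 0) (𝓝 (∫ t, m * g t))

/-- An algebra with mean value: a closed, conjugation-invariant subalgebra of `BUC(ℝ)` containing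
the constants (both are built into `StarSubalgebra ℂ`), invariant under translations, each of
whose elements has a mean value. -/
structure AlgebraWithMeanValue where
  toStarSubalgebra : StarSubalgebra ℂ (ℝ →ᵇ ℂ)
  isClosed' : IsClosed (toStarSubalgebra : Set (ℝ →ᵇ ℂ))
  uniformContinuous' : ∀ f ∈ toStarSubalgebra, UniformContinuous f
  translate_mem' : ∀ f ∈ toStarSubalgebra, ∀ a : ℝ,
    f.compContinuous ⟨fun t : ℝ => t - a, by fun_prop⟩ ∈ toStarSubalgebra
  exists_mean' : ∀ f ∈ toStarSubalgebra, ∃ m : ℂ, HasMeanValue f m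

namespace AlgebraWithMeanValue

variable (A : AlgebraWithMeanValue)

/-- The algebra as a type; it is a commutative unital C⋆-algebra with the supremum norm. -/
abbrev Alg : Type := A.toStarSubalgebra

instance : IsClosed (A.toStarSubalgebra : Set (ℝ →ᵇ ℂ)) := A.isClosed'

/-- The spectrum `Δ(A)`: the characters of `A`, with the weak-* topology. -/
abbrev Spectrum : Type := WeakDual.characterSpace ℂ A.Alg

instance : MeasurableSpace A.Spectrum := borel _

instance : BorelSpace A.Spectrum := ⟨rfl⟩

/-- The mean value `M(f)`. -/
def mean (f : A.Alg) : ℂ := Classical.choose (A.exists_mean' f.1 f.2)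

theorem hasMeanValue_mean (f : A.Alg) : HasMeanValue f.1 (A.mean f) :=
  Classical.choose_spec (A.exists_mean' f.1 f.2)

end AlgebraWithMeanValue

theorem HasMeanValue.tendsto {f : ℝ → ℂ} {m : ℂ} (h : HasMeanValue f m) :
    Tendsto (fun ε : ℝ => ∫ t in Icc (0 : ℝ) 1, f (t / ε)) (𝓝[>] 0) (𝓝 m) := by
  have hg : Integrable (indicator (Icc (0 : ℝ) 1) (fun _ => (1 : ℂ))) volume := by
    rw [integrable_indicator_iff measurableSet_Icc]
    exact integrableOn_const (by simp)
  have key : ∀ φ : ℝ → ℂ, (∫ t, φ t * indicator (Icc (0 : ℝ) 1) (fun _ => (1 : ℂ)) t)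
      = ∫ t in Icc (0 : ℝ) 1, φ t := by
    intro φ
    rw [← integral_indicator measurableSet_Icc]
    congr 1
    ext t
    by_cases ht : t ∈ Icc (0 : ℝ) 1 <;> simp [ht]
  have := h _ hg
  rw [key (fun _ => m)] at this
  simpa [key] using this

namespace AlgebraWithMeanValue

variable (A : AlgebraWithMeanValue)

theorem integrableOn_rescale (f : A.Alg) (ε : ℝ) :
    IntegrableOn (fun t : ℝ => f.1 (t / ε)) (Icc (0 : ℝ) 1) volume :=
  (f.1.continuous.comp (by fun_prop)).continuousOn.integrableOn_compact isCompact_Icc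

theorem mean_add (f g : A.Alg) : A.mean (f + g) = A.mean f + A.mean g := by
  refine tendsto_nhds_unique (A.hasMeanValue_mean (f + g)).tendsto ?_
  refine ((A.hasMeanValue_mean f).tendsto.add (A.hasMeanValue_mean g).tendsto).congr fun ε => ?_
  rw [← integral_add (A.integrableOn_rescale f ε) (A.integrableOn_rescale g ε)]
  rfl

theorem mean_smul (c : ℂ) (f : A.Alg) : A.mean (c • f) = c * A.mean f := by
  refine tendsto_nhds_unique (A.hasMeanValue_mean (c • f)).tendsto ?_
  refine ((A.hasMeanValue_mean f).tendsto.const_mul c).congr fun ε => ?_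
  rw [← integral_const_mul]
  rfl

theorem mean_one : A.mean 1 = 1 := by
  refine tendsto_nhds_unique (A.hasMeanValue_mean 1).tendsto ?_
  have h : ∀ ε : ℝ, (∫ t in Icc (0 : ℝ) 1, (1 : A.Alg).1 (t / ε)) = 1 := by
    intro ε
    simp
  simp only [h]
  exact tendsto_const_nhds

theorem mean_star_mul_self_nonneg (f : A.Alg) : 0 ≤ (A.mean (star f * f)).re := by
  refine ge_of_tendsto' (Complex.continuous_re.continuousAt.tendsto.comp
    (A.hasMeanValue_mean (star f * f)).tendsto) fun ε => ?_
  have h : ∀ x : ℝ, (star f * f).1 x = ((‖f.1 x‖ ^ 2 : ℝ) : ℂ) := by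
    intro x
    change (starRingEnd ℂ) (f.1 x) * f.1 x = _
    rw [mul_comm, Complex.mul_conj']
    simp
  simp only [h, Function.comp_apply]
  rw [integral_complex_ofReal, Complex.ofReal_re]
  exact integral_nonneg fun x => by positivity

/-- A real continuous function on the spectrum, regarded as a complex one. -/
def toComplexFun (g : CompactlySupportedContinuousMap A.Spectrum ℝ) : C(A.Spectrum, ℂ) :=
  ⟨fun s => (g s : ℂ), by fun_prop⟩

/-- The mean value transported to `C(Δ(A), ℝ)` by the Gelfand isomorphism `A ≃ C(Δ(A))`; it is a
positive linear functional. -/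
def spectralMean : CompactlySupportedContinuousMap A.Spectrum ℝ →ₚ[ℝ] ℝ :=
  PositiveLinearMap.mk₀
    { toFun := fun g => (A.mean ((gelfandStarTransform A.Alg).symm (A.toComplexFun g))).re
      map_add' := by
        intro f g
        have : A.toComplexFun (f + g) = A.toComplexFun f + A.toComplexFun g := by
          ext s; simp [toComplexFun]
        rw [this, map_add, mean_add, Complex.add_re]
      map_smul' := by
        intro c g
        have : A.toComplexFun (c • g) = (c : ℂ) • A.toComplexFun g := by
          ext s; simp [toComplexFun]
        rw [this, map_smul, mean_smul, Complex.re_ofReal_mul]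
        rfl }
    (by
      intro g hg
      let h : C(A.Spectrum, ℂ) := ⟨fun s => (Real.sqrt (g s) : ℂ), by fun_prop⟩
      have hh : A.toComplexFun g = star h * h := by
        ext s
        have hs : 0 ≤ g s := hg s
        change (g s : ℂ) = (starRingEnd ℂ) (Real.sqrt (g s) : ℂ) * (Real.sqrt (g s) : ℂ)
        rw [Complex.conj_ofReal, ← Complex.ofReal_mul, Real.mul_self_sqrt hs]
      change 0 ≤ (A.mean ((gelfandStarTransform A.Alg).symm (A.toComplexFun g))).re
      rw [hh, map_mul, map_star]
      exact A.mean_star_mul_self_nonneg _)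

/-- The measure `β` on `Δ(A)` that represents the mean value (Riesz representation). -/
def meanMeasure : Measure A.Spectrum := RealRMK.rieszMeasure A.spectralMean

theorem re_integral_meanMeasure (g : CompactlySupportedContinuousMap A.Spectrum ℝ) :
    ∫ s, g s ∂A.meanMeasure
      = (A.mean ((gelfandStarTransform A.Alg).symm (A.toComplexFun g))).re :=
  RealRMK.integral_rieszMeasure A.spectralMean g

instance : IsFiniteMeasure A.meanMeasure := by
  unfold meanMeasure; infer_instance

instance : A.meanMeasure.Regular := by
  unfold meanMeasure; infer_instance

/-- The measure `β` represents the mean value: `M(f) = ∫ f̂ dβ`. -/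
theorem mean_eq_integral (f : A.Alg) :
    A.mean f = ∫ s, WeakDual.gelfandTransform ℂ A.Alg f s ∂A.meanMeasure := by
  let G := gelfandStarTransform A.Alg
  let r : CompactlySupportedContinuousMap A.Spectrum ℝ :=
    CompactlySupportedContinuousMap.continuousMapEquiv ⟨fun s => (G f s).re, by fun_prop⟩
  let i : CompactlySupportedContinuousMap A.Spectrum ℝ :=
    CompactlySupportedContinuousMap.continuousMapEquiv ⟨fun s => (G f s).im, by fun_prop⟩
  have hint : Integrable (fun s => G f s) A.meanMeasure :=
    (G f).continuous.integrable_of_hasCompactSupport (HasCompactSupport.of_compactSpace _)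
  have hreal : ∀ g : CompactlySupportedContinuousMap A.Spectrum ℝ,
      (A.mean (G.symm (A.toComplexFun g))).im = 0 := by
    intro g
    have hsa : star (G.symm (A.toComplexFun g)) = G.symm (A.toComplexFun g) := by
      rw [← map_star]
      congr 1
      ext s
      exact Complex.conj_ofReal _
    have hval : ∀ x : ℝ, ((G.symm (A.toComplexFun g)).1 x).im = 0 := fun x =>
      Complex.conj_eq_iff_im.1 (congrArg (fun h : A.Alg => h.1 x) hsa)
    refine tendsto_nhds_unique (Complex.continuous_im.continuousAt.tendsto.comp
      (A.hasMeanValue_mean _).tendsto) ?_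
    refine tendsto_const_nhds.congr fun ε => ?_
    have := integral_im (𝕜 := ℂ) (A.integrableOn_rescale (G.symm (A.toComplexFun g)) ε)
    simp only [RCLike.im_eq_complex_im, hval, integral_zero] at this
    exact this
  have hf : f = G.symm (A.toComplexFun r) + Complex.I • G.symm (A.toComplexFun i) := by
    apply EquivLike.injective G
    rw [map_add, map_smul, G.apply_symm_apply, G.apply_symm_apply]
    ext s
    change G f s = ((G f s).re : ℂ) + Complex.I * ((G f s).im : ℂ)
    rw [mul_comm, Complex.re_add_im]
  have h1 : ∫ s, (G f s).re ∂A.meanMeasure = (∫ s, G f s ∂A.meanMeasure).re := integral_re hint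
  have h2 : ∫ s, (G f s).im ∂A.meanMeasure = (∫ s, G f s ∂A.meanMeasure).im := integral_im hint
  have hr : ∫ s, (G f s).re ∂A.meanMeasure = (A.mean (G.symm (A.toComplexFun r))).re :=
    A.re_integral_meanMeasure r
  have hi : ∫ s, (G f s).im ∂A.meanMeasure = (A.mean (G.symm (A.toComplexFun i))).re :=
    A.re_integral_meanMeasure i
  change A.mean f = ∫ s, G f s ∂A.meanMeasure
  have hm : A.mean f = A.mean (G.symm (A.toComplexFun r))
      + Complex.I * A.mean (G.symm (A.toComplexFun i)) := by
    conv_lhs => rw [hf]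
    rw [mean_add, mean_smul]
  rw [hm]
  apply Complex.ext
  · simp [hreal, ← hr, h1]
  · simp [hreal, ← hi, h2]

instance : IsProbabilityMeasure A.meanMeasure := by
  have h := A.mean_eq_integral 1
  rw [mean_one, map_one] at h
  have h2 : A.meanMeasure.real univ = 1 := by
    have : (1 : ℂ) = (A.meanMeasure.real univ : ℂ) := by simpa using h
    exact_mod_cast this.symm
  exact ⟨by simpa [Measure.real, ENNReal.toReal_eq_one_iff] using h2⟩

/-- The torus `𝕋^d = ℝ^d / ℤ^d`; its `volume` is the product Haar probability measure. -/
abbrev Torus (d : ℕ) : Type := UnitAddTorus (Fin d)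

/-- The product algebra `A ⊙ C(𝕋^d)`: the uniform closure, among bounded continuous functions of
`(τ, y) ∈ ℝ × 𝕋^d`, of the span of the products `f(τ) g(y)` with `f ∈ A`, `g ∈ C(𝕋^d)`. -/
def productAlgebra (d : ℕ) : Submodule ℂ ((ℝ × Torus d) →ᵇ ℂ) :=
  (Submodule.span ℂ {F : (ℝ × Torus d) →ᵇ ℂ | ∃ f : A.Alg, ∃ g : C(Torus d, ℂ),
    ∀ (τ : ℝ) (y : Torus d), F (τ, y) = f.1 τ * g y}).topologicalClosure

variable {d : ℕ}

/-- The slice `F(·, y)` of a bounded continuous function on `ℝ × 𝕋^d`. -/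
def slice (F : (ℝ × Torus d) →ᵇ ℂ) (y : Torus d) : ℝ →ᵇ ℂ :=
  F.compContinuous ⟨fun τ : ℝ => (τ, y), by fun_prop⟩

theorem slice_mem (F : A.productAlgebra d) (y : Torus d) :
    slice F.1 y ∈ A.toStarSubalgebra := by
  let L : ((ℝ × Torus d) →ᵇ ℂ) →ₗ[ℂ] (ℝ →ᵇ ℂ) :=
    { toFun := fun F => slice F y
      map_add' := fun _ _ => rfl
      map_smul' := fun _ _ => rfl }
  have hL : Continuous L := BoundedContinuousFunction.continuous_compContinuous _
  let S : Submodule ℂ (ℝ →ᵇ ℂ) := Subalgebra.toSubmodule A.toStarSubalgebra.toSubalgebra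
  have hS : IsClosed ((S.comap L : Submodule ℂ _) : Set ((ℝ × Torus d) →ᵇ ℂ)) :=
    A.isClosed'.preimage hL
  refine Submodule.topologicalClosure_minimal _ (Submodule.span_le.2 ?_) hS F.2
  rintro G ⟨f, g, hG⟩
  have : L G = (g y • f : A.Alg).1 := by
    ext τ
    exact (hG τ y).trans (mul_comm _ _)
  change L G ∈ A.toStarSubalgebra
  rw [this]
  exact (g y • f : A.Alg).2

/-- The Gelfand transform in the variable `τ`: `F̂(s, y) = s(F(·, y))`. -/
def gelfandHat (F : A.productAlgebra d) (p : A.Spectrum × Torus d) : ℂ :=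
  WeakDual.gelfandTransform ℂ A.Alg ⟨slice F.1 p.2, A.slice_mem F p.2⟩ p.1

end AlgebraWithMeanValue

/-- The space `ℝ^d` with the Euclidean norm. -/
abbrev Space (d : ℕ) : Type := EuclideanSpace ℝ (Fin d)

/-- The class in `𝕋^d` of a point of `ℝ^d`. -/
def toTorus {d : ℕ} (x : Space d) : UnitAddTorus (Fin d) := fun i => (x i : UnitAddCircle)

/-- The Jacobian `J(τ, x)`: by convention the derivative in `x` of the backward map `Φ_{-τ}`. -/
def flowJacobian {d : ℕ} (Φ : ℝ → Space d → Space d) (τ : ℝ) (x : Space d) :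
    Space d →L[ℝ] Space d :=
  fderiv ℝ (Φ (-τ)) x

/-- The standing assumptions on the flow `Φ_τ(x)`. -/
structure IsAdmissibleFlow {d : ℕ} (Φ : ℝ → Space d → Space d) : Prop where
  contDiff : ContDiff ℝ 1 (fun p : ℝ × Space d => Φ p.1 p.2)
  group : ∀ (t s : ℝ) (x : Space d), Φ t (Φ s x) = Φ (t + s) x
  jacobian_bounded : ∀ K : Set (Space d), IsCompact K →
    ∃ C : ℝ, ∀ x ∈ K, ∀ τ : ℝ, ‖flowJacobian Φ τ x‖ ≤ C
  volume_preserving : ∀ (τ : ℝ) (x : Space d), (flowJacobian Φ τ x).det = 1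

/-- Lebesgue measure on `(0,T) × ℝ^d`. -/
def spaceTimeMeasure (d : ℕ) (T : ℝ) : Measure (ℝ × Space d) :=
  volume.restrict (Ioo 0 T ×ˢ univ)

/-- The measure `dt dX dβ(s) dy` on `(0,T) × ℝ^d × Δ(A) × 𝕋^d`. -/
def limitMeasure (A : AlgebraWithMeanValue) (d : ℕ) (T : ℝ) :
    Measure ((ℝ × Space d) × (A.Spectrum × UnitAddTorus (Fin d))) :=
  (spaceTimeMeasure d T).prod (A.meanMeasure.prod volume)

/-- Test functions `ψ(t, X, τ, y)`: smooth functions of `(t, X) ∈ (0,T) × ℝ^d` with values in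
`A ⊙ C(𝕋^d)` and square-integrable norm. This includes all the smooth ones with compact
support in `(0,T) × ℝ^d` or in `[0,T] × ℝ^d`. -/
structure IsTestFunction (A : AlgebraWithMeanValue) {d : ℕ} (T : ℝ)
    (ψ : ℝ × Space d → A.productAlgebra d) : Prop where
  smooth : ContDiffOn ℝ ∞ ψ (Ioo 0 T ×ˢ univ)
  memLp : MemLp ψ 2 (spaceTimeMeasure d T)

/-- Weak `Σ`-convergence along the flow `Φ` of the sequence `u n`, attached to the parameters
`ε n`, to the limit `u₀`. -/
def WeaklySigmaConverges (A : AlgebraWithMeanValue) {d : ℕ} (T : ℝ) (Φ : ℝ → Space d → Space d)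
    (ε : ℕ → ℝ) (u : ℕ → Lp ℂ 2 (spaceTimeMeasure d T)) (u₀ : Lp ℂ 2 (limitMeasure A d T)) :
    Prop :=
  ∀ ψ : ℝ × Space d → A.productAlgebra d, IsTestFunction A T ψ →
    Tendsto
      (fun n => ∫ p, u n p * (ψ (p.1, Φ (-p.1 / ε n) p.2)).1
        (p.1 / ε n, toTorus ((ε n)⁻¹ • p.2)) ∂spaceTimeMeasure d T)
      atTop
      (𝓝 (∫ q, u₀ q * A.gelfandHat (ψ q.1) q.2 ∂limitMeasure A d T))

end

/-! Put R ψ = ψ̂ (`gelfandOp`) and Rₙ ψ = ψ(t, Φ_{-t/εₙ}(x), t/εₙ, x/εₙ) (`traceOp`), contractions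
from the L² space of A ⊙ C(𝕋^d)-valued functions on space-time into scalar L² spaces. The claim is
that ⟪conj uₙ, Rₙ ψ⟫ converges along a subsequence to some ⟪w, R ψ⟫. Everything rests on ‖Rₙ ψ‖ → ‖R
ψ‖: a limit of these functionals is then dominated by C‖R ψ‖, hence represented by a vector w.

Since A may be nonseparable, no diagonal extraction over a dense set is available. In
`exists_subseq_tendsto_inner` every ultrafilter on ℕ finer than `atTop` receives its limit vector,
taken in the closure of the range of R. Among the limits below a given filter, one has almost
maximal norm; prescribing the limit of the pairing with a single test vector close to it forces all
remaining limits to be near it. Countably many such prescriptions leave one limit, and the resulting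
filter is still countably generated, so a sequence converges along it.

For the norms, `tendsto_inner_of_generators` reduces to ψ = 1_s(t,X) f(τ) e_k(y). Inner products of
such functions are integrals of w(t, Φ_{-t/ε}(x)) f(t/ε) e_k(x/ε). If k = 0, volume preservation
removes the flow and the mean value of f gives the limit. If k ≠ 0, a shift of x by half a period
changes the sign of e_k, so for smooth w the integral is O(ε) times a Lipschitz constant of x ↦ w(t,
Φ_{-t/ε}(x)). That constant is uniform in t/ε: the derivatives of the flow are inverses of Jacobians
that are bounded over compact sets and have determinant one. -/

/-! ### Weak compactness without separability -/

section WeakCompactness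

variable {X H K : Type*} [AddCommGroup X] [Module ℂ X]
  [NormedAddCommGroup H] [InnerProductSpace ℂ H] [CompleteSpace H]
  [NormedAddCommGroup K] [InnerProductSpace ℂ K]

/-- A linear functional dominated by `C * ‖R x‖` is represented by a vector in the closure of
the range of `R`. -/
theorem exists_inner_eq_of_norm_le (R : X →ₗ[ℂ] H) (l : X →ₗ[ℂ] ℂ) {C : ℝ} (hC : 0 ≤ C)
    (hl : ∀ x, ‖l x‖ ≤ C * ‖R x‖) :
    ∃ w ∈ closure (range R), ‖w‖ ≤ C ∧ ∀ x, l x = inner ℂ w (R x) := by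
  -- The domination makes `l` vanish on the kernel of `R`, so `l ∘ σ` is the functional induced by
  -- `l` on the range, whichever section `σ` is chosen.
  obtain ⟨σ, hσ⟩ := R.rangeRestrict.exists_rightInverse_of_surjective R.range_rangeRestrict
  have hσ' : ∀ y : LinearMap.range R, R (σ y) = y := fun y =>
    congrArg Subtype.val (LinearMap.congr_fun hσ y)
  let g : LinearMap.range R →L[ℂ] ℂ := (l ∘ₗ σ).mkContinuous C fun y => by
    have := hl (σ y)
    rwa [hσ'] at this
  obtain ⟨G, hG, hGn⟩ := exists_extension_norm_eq _ g
  let w₀ : H := (InnerProductSpace.toDual ℂ H).symm G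
  have hw₀ : ∀ y, inner ℂ w₀ y = G y := fun y => by
    simp [w₀]
  have hw₀n : ‖w₀‖ ≤ C := by
    have : ‖w₀‖ = ‖G‖ := by simp [w₀]
    rw [this, hGn]
    exact LinearMap.mkContinuous_norm_le _ hC _
  -- Projecting onto the closed range does not change the pairings with vectors `R x`.
  let M := (LinearMap.range R).topologicalClosure
  have : CompleteSpace M := (LinearMap.range R).isClosed_topologicalClosure.completeSpace_coe
  refine ⟨M.starProjection w₀, M.starProjection_apply_mem w₀, ?_, fun x => ?_⟩
  · exact (M.norm_starProjection_apply_le w₀).trans hw₀n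
  · have hx : R x ∈ M := (LinearMap.range R).le_topologicalClosure (LinearMap.mem_range_self R x)
    rw [M.inner_starProjection_left_eq_right, M.starProjection_eq_self_iff.2 hx, hw₀]
    have h1 := hG ⟨R x, LinearMap.mem_range_self R x⟩
    rw [h1]
    change l x = l (σ _)
    have h2 := hl (x - σ ⟨R x, LinearMap.mem_range_self R x⟩)
    rw [map_sub, map_sub, hσ', sub_self, norm_zero, mul_zero] at h2
    exact sub_eq_zero.1 (norm_le_zero_iff.1 h2)

/-- Bounded scalar sequences converge along an ultrafilter, so the limit functional exists for all
`x` at once. Cauchy–Schwarz and the convergence of norms bound it by `C * ‖R x‖`. Membership in the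
closure of the range lets a later step approximate `w` by some `R x`. -/
theorem exists_ultrafilter_limit (R : X →ₗ[ℂ] H) (Rn : ℕ → X →ₗ[ℂ] K)
    (hR : ∀ x, Tendsto (fun n => ‖Rn n x‖) atTop (𝓝 ‖R x‖))
    (v : ℕ → K) {C : ℝ} (hv : ∀ n, ‖v n‖ ≤ C) (U : Ultrafilter ℕ) (hU : (U : Filter ℕ) ≤ atTop) :
    ∃ w ∈ closure (range R), ‖w‖ ≤ C ∧
      ∀ x, Tendsto (fun n => inner ℂ (v n) (Rn n x)) U (𝓝 (inner ℂ w (R x))) := by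
  have hC : 0 ≤ C := (norm_nonneg _).trans (hv 0)
  have hb : ∀ x n, ‖inner ℂ (v n) (Rn n x)‖ ≤ C * ‖Rn n x‖ := fun x n =>
    (norm_inner_le_norm _ _).trans (mul_le_mul_of_nonneg_right (hv n) (norm_nonneg _))
  have hlim : ∀ x, ∃ z : ℂ, Tendsto (fun n => inner ℂ (v n) (Rn n x)) U (𝓝 z) := by
    intro x
    have h1 : ∀ᶠ n in (U : Filter ℕ), ‖Rn n x‖ ≤ ‖R x‖ + 1 :=
      hU ((hR x).eventually_le_const (by linarith))
    have h2 : ∀ᶠ n in (U : Filter ℕ), inner ℂ (v n) (Rn n x) ∈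
        Metric.closedBall (0 : ℂ) (C * (‖R x‖ + 1)) := by
      filter_upwards [h1] with n hn
      rw [mem_closedBall_zero_iff]
      exact (hb x n).trans (mul_le_mul_of_nonneg_left hn hC)
    obtain ⟨z, -, hz⟩ := (isCompact_closedBall (0 : ℂ) (C * (‖R x‖ + 1))).ultrafilter_le_nhds
      (U.map fun n => inner ℂ (v n) (Rn n x)) (le_principal_iff.2 h2)
    exact ⟨z, hz⟩
  choose l hl using hlim
  let L : X →ₗ[ℂ] ℂ :=
    { toFun := l
      map_add' := fun x y => tendsto_nhds_unique (hl (x + y)) (by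
        simpa only [map_add, inner_add_right] using (hl x).add (hl y))
      map_smul' := fun c x => tendsto_nhds_unique (hl (c • x)) (by
        simpa only [map_smul, inner_smul_right, RingHom.id_apply, smul_eq_mul] using
          (hl x).const_mul c) }
  obtain ⟨w, hw, hwC, hwl⟩ := exists_inner_eq_of_norm_le R L hC fun x =>
    le_of_tendsto_of_tendsto (hl x).norm (((hR x).mono_left hU).const_mul C)
      (Eventually.of_forall (hb x))
  exact ⟨w, hw, hwC, fun x => hwl x ▸ hl x⟩

/-- If `‖Rₙ x‖ → ‖R x‖` for every `x`, then every bounded sequence `vₙ` has a subsequence along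
which the functionals `x ↦ ⟪vₙ, Rₙ x⟫` converge pointwise to some `x ↦ ⟪w, R x⟫`. No
separability is needed. -/
theorem exists_subseq_tendsto_inner (R : X →ₗ[ℂ] H) (Rn : ℕ → X →ₗ[ℂ] K)
    (hR : ∀ x, Tendsto (fun n => ‖Rn n x‖) atTop (𝓝 ‖R x‖))
    (v : ℕ → K) {C : ℝ} (hv : ∀ n, ‖v n‖ ≤ C) :
    ∃ k : ℕ → ℕ, StrictMono k ∧ ∃ w : H, ∀ x,
      Tendsto (fun n => inner ℂ (v (k n)) (Rn (k n) x)) atTop (𝓝 (inner ℂ w (R x))) := by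
  have hC : 0 ≤ C := (norm_nonneg _).trans (hv 0)
  have hex := exists_ultrafilter_limit R Rn hR v hv
  choose! W hW using hex
  -- Countable generation is what finally turns a filter into a subsequence.
  let P : Filter ℕ → Prop := fun F => F.NeBot ∧ F.IsCountablyGenerated ∧ F ≤ atTop
  have step : ∀ (F : {F // P F}) (δ : ℝ), 0 < δ → ∃ F' : {F // P F}, F'.1 ≤ F.1 ∧
      ∃ w : H, ∀ U : Ultrafilter ℕ, (U : Filter ℕ) ≤ F'.1 → ‖W U - w‖ ≤ δ := by
    rintro ⟨F, hF, hFc, hFt⟩ δ hδ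
    -- With a = ‖W U₀‖ ≤ C, the estimates below give ‖W U - W U₀‖² ≤ (a + η)² - a² + 4Cη ≤ (6C +
    -- 1)η, using η ≤ 1.
    obtain ⟨η, hη, hη1, hηδ⟩ : ∃ η : ℝ, 0 < η ∧ η ≤ 1 ∧ (6 * C + 1) * η ≤ δ ^ 2 := by
      refine ⟨min 1 (δ ^ 2 / (6 * C + 1)), by positivity, min_le_left _ _, ?_⟩
      have := min_le_right 1 (δ ^ 2 / (6 * C + 1))
      rw [le_div_iff₀ (by positivity)] at this
      linarith
    let S : Set ℝ := {r | ∃ U : Ultrafilter ℕ, (U : Filter ℕ) ≤ F ∧ r = ‖W U‖}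
    have hSne : S.Nonempty := ⟨_, Ultrafilter.of F, Ultrafilter.of_le F, rfl⟩
    have hSb : BddAbove S := ⟨C, by rintro r ⟨U, hU, rfl⟩; exact (hW U (hU.trans hFt)).2.1⟩
    -- Near-maximality of ‖W U₀‖ bounds the norm of every competitor; without it, an almost
    -- prescribed inner product with W U₀ would not bring W U close.
    obtain ⟨_, ⟨U₀, hU₀, rfl⟩, hlt⟩ := exists_lt_of_lt_csSup hSne
      (show sSup S - η < sSup S by linarith)
    obtain ⟨hcl, hn₀, hlim₀⟩ := hW U₀ (hU₀.trans hFt)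
    obtain ⟨_, ⟨x, rfl⟩, hx⟩ := Metric.mem_closure_iff.1 hcl η hη
    have hU₀' : (U₀ : Filter ℕ) ≤
        F ⊓ comap (fun n => inner ℂ (v n) (Rn n x)) (𝓝 (inner ℂ (W U₀) (R x))) :=
      le_inf hU₀ (hlim₀ x).le_comap
    -- The refinement prescribes the limit of one scalar sequence. It stays nontrivial because `U₀`
    -- satisfies it, and countably generated because ℂ is first countable.
    refine ⟨⟨F ⊓ comap (fun n => inner ℂ (v n) (Rn n x)) (𝓝 (inner ℂ (W U₀) (R x))),
      U₀.neBot.mono hU₀', inferInstance, inf_le_left.trans hFt⟩, inf_le_left, W U₀,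
      fun U hU => ?_⟩
    have hUF : (U : Filter ℕ) ≤ F := hU.trans inf_le_left
    obtain ⟨-, hn, hlim⟩ := hW U (hUF.trans hFt)
    have heq : inner ℂ (W U) (R x) = inner ℂ (W U₀) (R x) :=
      tendsto_nhds_unique (hlim x) (tendsto_iff_comap.2 (hU.trans inf_le_right))
    have hmax : ‖W U‖ ≤ ‖W U₀‖ + η := by
      have := le_csSup hSb ⟨U, hUF, rfl⟩
      linarith
    rw [dist_eq_norm] at hx
    have e1 : inner ℂ (W U) (W U₀) = inner ℂ (W U) (W U₀ - R x)
        - inner ℂ (W U₀) (W U₀ - R x) + inner ℂ (W U₀) (W U₀) := by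
      simp only [inner_sub_right, heq]; ring
    have e2 : ‖inner ℂ (W U) (W U₀ - R x)‖ ≤ C * η :=
      (norm_inner_le_norm _ _).trans (mul_le_mul hn hx.le (norm_nonneg _) hC)
    have e3 : ‖inner ℂ (W U₀) (W U₀ - R x)‖ ≤ C * η :=
      (norm_inner_le_norm _ _).trans (mul_le_mul hn₀ hx.le (norm_nonneg _) hC)
    have e4 : (inner ℂ (W U) (W U₀)).re = (inner ℂ (W U) (W U₀ - R x)).re
        - (inner ℂ (W U₀) (W U₀ - R x)).re + ‖W U₀‖ ^ 2 := by
      rw [e1, Complex.add_re, Complex.sub_re, inner_self_eq_norm_sq_to_K]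
      norm_cast
    have e5 := (abs_le.1 ((Complex.abs_re_le_norm _).trans e2)).1
    have e6 := (abs_le.1 ((Complex.abs_re_le_norm _).trans e3)).2
    have e7 := norm_sub_sq (𝕜 := ℂ) (W U) (W U₀)
    rw [RCLike.re_eq_complex_re, e4] at e7
    refine abs_le_of_sq_le_sq' ?_ hδ.le |>.2
    nlinarith [norm_nonneg (W U), norm_nonneg (W U₀), mul_le_mul hmax hmax (norm_nonneg _)
      (by positivity)]
  choose! next hnext using step
  let F : ℕ → {F // P F} := fun n =>
    Nat.rec ⟨atTop, inferInstance, inferInstance, le_rfl⟩ (fun n G => next G (1 / ((n : ℝ) + 1))) n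
  have hpos : ∀ n : ℕ, (0 : ℝ) < 1 / ((n : ℝ) + 1) := fun n => by positivity
  have hF : ∀ n, (F (n + 1)).1 ≤ (F n).1 := fun n => (hnext (F n) _ (hpos n)).1
  let G : Filter ℕ := ⨅ n, (F n).1
  have hGle : ∀ n, G ≤ (F n).1 := fun n => iInf_le _ n
  have hGne : G.NeBot := by
    refine iInf_neBot_of_directed' ?_ fun n => (F n).2.1
    exact (antitone_nat_of_succ_le hF).directed_ge
  have : ∀ n, (F n).1.IsCountablyGenerated := fun n => (F n).2.2.1
  have hGc : G.IsCountablyGenerated := iInf.isCountablyGenerated _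
  have hGt : G ≤ atTop := (hGle 0).trans (F 0).2.2.2
  have huniq : ∀ U V : Ultrafilter ℕ, (U : Filter ℕ) ≤ G → (V : Filter ℕ) ≤ G → W U = W V := by
    intro U V hU hV
    have hle : ∀ n : ℕ, ‖W U - W V‖ ≤ 2 * (1 / ((n : ℝ) + 1)) := by
      intro n
      obtain ⟨w, hw⟩ := (hnext (F n) _ (hpos n)).2
      have h1 := hw U (hU.trans (hGle (n + 1)))
      have h2 := hw V (hV.trans (hGle (n + 1)))
      have h3 := norm_sub_le (W U - w) (W V - w)
      rw [sub_sub_sub_cancel_right] at h3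
      linarith
    have h0 : ‖W U - W V‖ ≤ 0 := by
      have := tendsto_one_div_add_atTop_nhds_zero_nat (𝕜 := ℝ) |>.const_mul 2
      rw [mul_zero] at this
      exact ge_of_tendsto' this hle
    exact sub_eq_zero.1 (norm_le_zero_iff.1 h0)
  obtain ⟨k₀, hk₀⟩ := exists_seq_tendsto G
  -- The sequence converging to `G` tends to infinity but need not be increasing; it is thinned out.
  obtain ⟨φ, hφ, hkφ⟩ := strictMono_subseq_of_tendsto_atTop (hk₀.mono_right hGt)
  refine ⟨k₀ ∘ φ, hkφ, W (Ultrafilter.of G), fun x => ?_⟩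
  have hG : Tendsto (fun n => inner ℂ (v n) (Rn n x)) G
      (𝓝 (inner ℂ (W (Ultrafilter.of G)) (R x))) := by
    rw [tendsto_iff_ultrafilter]
    intro U hU
    rw [huniq _ U (Ultrafilter.of_le G) hU]
    exact (hW U (hU.trans hGt)).2.2 x
  exact hG.comp (hk₀.comp hφ.tendsto_atTop)

end WeakCompactness

/-! ### Composition operators on vector-valued L² -/

section EvaluationOperator

variable {P Z E : Type*} [MeasurableSpace P] [MeasurableSpace Z] [NormedAddCommGroup E]
  [NormedSpace ℂ E] {μ : Measure P} {ν : Measure Z}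

/-- For a simple `φ` only finitely many functions `Λ · F` are involved; the general case is a
pointwise limit, by continuity of each `Λ z`. `E` itself need not be separable. -/
theorem stronglyMeasurable_apply_of_forall_measurable {Λ : Z → E →L[ℂ] ℂ}
    (hm : ∀ F, Measurable fun z => Λ z F) {φ : Z → E} (hφ : StronglyMeasurable φ) :
    StronglyMeasurable fun z => Λ z (φ z) := by
  refine stronglyMeasurable_of_tendsto atTop (f := fun n z => Λ z (hφ.approx n z))
    (fun n => ?_) ?_
  · exact ((hφ.approx n).measurable_bind (fun F z => Λ z F) hm).stronglyMeasurable
  · rw [tendsto_pi_nhds]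
    exact fun z => ((Λ z).continuous.tendsto _).comp (hφ.tendsto_approx z)

theorem memLp_apply_comp {Λ : Z → E →L[ℂ] ℂ} (hm : ∀ F, Measurable fun z => Λ z F)
    (hΛ : ∀ z, ‖Λ z‖ ≤ 1) {π : Z → P} (hπ : MeasurePreserving π ν μ) {ψ : P → E}
    (hψ : MemLp ψ 2 μ) : MemLp (fun z => Λ z (ψ (π z))) 2 ν := by
  have h := hψ.comp_measurePreserving hπ
  refine h.mono ?_ (Eventually.of_forall fun z => ?_)
  · obtain ⟨φ, hφ, hφe⟩ := h.aestronglyMeasurable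
    refine ⟨_, stronglyMeasurable_apply_of_forall_measurable hm hφ, ?_⟩
    filter_upwards [hφe] with z hz
    rw [← hz]; rfl
  · exact ((Λ z).le_of_opNorm_le (hΛ z) _).trans_eq (one_mul _)

/-- The operator `ψ ↦ (z ↦ Λ z (ψ (π z)))` between `L²` spaces, for a measure preserving map `π`
and a weakly measurable family `Λ` of functionals of norm at most one. -/
noncomputable def evalOp (Λ : Z → E →L[ℂ] ℂ) (hm : ∀ F, Measurable fun z => Λ z F)
    (hΛ : ∀ z, ‖Λ z‖ ≤ 1) (π : Z → P) (hπ : MeasurePreserving π ν μ) :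
    Lp E 2 μ →L[ℂ] Lp ℂ 2 ν :=
  LinearMap.mkContinuous
    { toFun := fun ψ => (memLp_apply_comp hm hΛ hπ (Lp.memLp ψ)).toLp
      map_add' := fun ψ φ => by
        rw [← MemLp.toLp_add]
        refine MemLp.toLp_congr _ _ ?_
        filter_upwards [hπ.quasiMeasurePreserving.ae_eq (Lp.coeFn_add ψ φ)] with z hz
        exact (congrArg (Λ z) hz).trans (map_add (Λ z) _ _)
      map_smul' := fun c ψ => by
        rw [RingHom.id_apply, ← MemLp.toLp_const_smul]
        refine MemLp.toLp_congr _ _ ?_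
        filter_upwards [hπ.quasiMeasurePreserving.ae_eq (Lp.coeFn_smul c ψ)] with z hz
        exact (congrArg (Λ z) hz).trans (map_smul (Λ z) c _) }
    1 (fun ψ => by
      rw [one_mul]
      have h : ‖(Lp.compMeasurePreserving π hπ ψ : Lp E 2 ν)‖ = ‖ψ‖ :=
        Lp.norm_compMeasurePreserving ψ hπ
      rw [← h]
      refine Lp.norm_le_norm_of_ae_le ?_
      filter_upwards [(memLp_apply_comp hm hΛ hπ (Lp.memLp ψ)).coeFn_toLp,
        Lp.coeFn_compMeasurePreserving ψ hπ] with z h1 h2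
      simp only [LinearMap.coe_mk, AddHom.coe_mk]
      rw [h1, h2]
      exact ((Λ z).le_of_opNorm_le (hΛ z) _).trans_eq (one_mul _))

variable {Λ : Z → E →L[ℂ] ℂ} (hm : ∀ F, Measurable fun z => Λ z F) (hΛ : ∀ z, ‖Λ z‖ ≤ 1)
  {π : Z → P} (hπ : MeasurePreserving π ν μ)

theorem norm_evalOp_le : ‖evalOp Λ hm hΛ π hπ‖ ≤ 1 :=
  LinearMap.mkContinuous_norm_le _ zero_le_one _

theorem coeFn_evalOp (ψ : Lp E 2 μ) :
    evalOp Λ hm hΛ π hπ ψ =ᵐ[ν] fun z => Λ z (ψ (π z)) :=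
  (memLp_apply_comp hm hΛ hπ (Lp.memLp ψ)).coeFn_toLp

theorem coeFn_evalOp_toLp {ψ : P → E} (hψ : MemLp ψ 2 μ) :
    evalOp Λ hm hΛ π hπ hψ.toLp =ᵐ[ν] fun z => Λ z (ψ (π z)) := by
  filter_upwards [coeFn_evalOp hm hΛ hπ hψ.toLp,
    hπ.quasiMeasurePreserving.ae_eq hψ.coeFn_toLp] with z h1 h2
  simp only [Function.comp_apply] at h2
  rw [h1, h2]

end EvaluationOperator

/-! ### Convergence on generators -/

section ConvergenceOfFunctionals

/-- For uniformly bounded functionals, the vectors where they converge to a given functional form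
a closed subspace. -/
theorem exists_submodule_tendsto {X : Type*} [NormedAddCommGroup X] [NormedSpace ℂ X]
    (l : ℕ → X →L[ℂ] ℂ) (l₀ : X →L[ℂ] ℂ) {C : ℝ} (hl : ∀ n, ‖l n‖ ≤ C) :
    ∃ V : Submodule ℂ X, IsClosed (V : Set X) ∧
      ∀ x, x ∈ V ↔ Tendsto (fun n => l n x) atTop (𝓝 (l₀ x)) := by
  let V : Submodule ℂ X :=
    { carrier := {x | Tendsto (fun n => l n x) atTop (𝓝 (l₀ x))}
      add_mem' := fun {x y} hx hy => by
        simpa only [mem_ofPred_eq, map_add] using Tendsto.add hx hy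
      zero_mem' := by simp
      smul_mem' := fun c x hx => by
        simpa only [mem_ofPred_eq, map_smul] using Tendsto.const_smul hx c }
  refine ⟨V, ?_, fun x => Iff.rfl⟩
  refine isClosed_of_closure_subset fun x hx => ?_
  change Tendsto (fun n => l n x) atTop (𝓝 (l₀ x))
  have hC : 0 ≤ C := (norm_nonneg _).trans (hl 0)
  rw [Metric.tendsto_atTop]
  intro δ hδ
  -- This makes (C + ‖l₀‖)‖x - y‖ < δ/2; the summand 1 keeps the denominator positive.
  obtain ⟨y, hy, hxy⟩ := Metric.mem_closure_iff.1 hx (δ / (2 * (C + ‖l₀‖ + 1))) (by positivity)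
  obtain ⟨N, hN⟩ := Metric.tendsto_atTop.1 hy (δ / 2) (by positivity)
  refine ⟨N, fun n hn => ?_⟩
  have h1 := hN n hn
  rw [dist_eq_norm] at *
  have h2 : ‖l n (x - y)‖ ≤ C * ‖x - y‖ := (l n).le_of_opNorm_le (hl n) _
  have h3 : ‖l₀ (x - y)‖ ≤ ‖l₀‖ * ‖x - y‖ := l₀.le_opNorm _
  rw [lt_div_iff₀ (by positivity)] at hxy
  have h4 : l n x - l₀ x = l n (x - y) - l₀ (x - y) + (l n y - l₀ y) := by
    simp only [map_sub]; ring
  rw [h4]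
  refine (norm_add_le _ _).trans_lt ?_
  have := norm_sub_le (l n (x - y)) (l₀ (x - y))
  nlinarith [norm_nonneg (x - y)]

/-- Convergence of the sesquilinear forms `⟪Rₙ x, Rₙ y⟫` may be checked on a set that is contained
in no proper closed subspace. -/
theorem tendsto_inner_of_generators {X H K : Type*} [NormedAddCommGroup X] [NormedSpace ℂ X]
    [NormedAddCommGroup H] [InnerProductSpace ℂ H] [NormedAddCommGroup K] [InnerProductSpace ℂ K]
    (R : X →L[ℂ] H) (Rn : ℕ → X →L[ℂ] K) (hRn : ∀ n, ‖Rn n‖ ≤ 1) (G : Set X)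
    (hG : ∀ V : Submodule ℂ X, IsClosed (V : Set X) → G ⊆ V → V = ⊤)
    (h : ∀ x ∈ G, ∀ y ∈ G, Tendsto (fun n => inner ℂ (Rn n x) (Rn n y)) atTop
      (𝓝 (inner ℂ (R x) (R y)))) (x y : X) :
    Tendsto (fun n => inner ℂ (Rn n x) (Rn n y)) atTop (𝓝 (inner ℂ (R x) (R y))) := by
  have key : ∀ x : X, (∀ y ∈ G, Tendsto (fun n => inner ℂ (Rn n x) (Rn n y)) atTop
      (𝓝 (inner ℂ (R x) (R y)))) → ∀ y, Tendsto (fun n => inner ℂ (Rn n x) (Rn n y)) atTop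
      (𝓝 (inner ℂ (R x) (R y))) := by
    intro x hx
    obtain ⟨V, hVc, hV⟩ := exists_submodule_tendsto
      (fun n => (innerSL ℂ (Rn n x)).comp (Rn n)) ((innerSL ℂ (R x)).comp R) (C := ‖x‖) (by
        intro n
        refine (ContinuousLinearMap.opNorm_comp_le _ _).trans ?_
        rw [innerSL_apply_norm]
        have h1 := (Rn n).le_of_opNorm_le (hRn n) x
        have h2 := hRn n
        nlinarith [norm_nonneg (Rn n x), norm_nonneg (Rn n)])
    intro y
    have : y ∈ V := by rw [hG V hVc fun z hz => (hV z).2 (hx z hz)]; trivial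
    exact (hV y).1 this
  have symm : ∀ x y : X, Tendsto (fun n => inner ℂ (Rn n x) (Rn n y)) atTop
      (𝓝 (inner ℂ (R x) (R y))) → Tendsto (fun n => inner ℂ (Rn n y) (Rn n x)) atTop
      (𝓝 (inner ℂ (R y) (R x))) := by
    intro x y hxy
    simpa only [Function.comp_def, inner_conj_symm] using
      (Complex.continuous_conj.tendsto _).comp hxy
  -- One slot is extended at a time, with conjugate symmetry exchanging them.
  exact key x (fun z hz => symm _ _ (key z (h z hz) x)) y

end ConvergenceOfFunctionals

/-! ### Uniform bounds for inverses -/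

section InverseBound

/-- On the operators of determinant one, a bound for the norm gives a bound for the norm of any
left inverse. -/
theorem exists_norm_inverse_le_of_det_eq_one {E : Type*} [NormedAddCommGroup E] [NormedSpace ℝ E]
    [FiniteDimensional ℝ E] (C : ℝ) :
    ∃ C' : ℝ, ∀ A B : E →L[ℝ] E, ‖A‖ ≤ C → A.det = 1 → A.comp B = ContinuousLinearMap.id ℝ E →
      ‖B‖ ≤ C' := by
  have : CompleteSpace E := FiniteDimensional.complete ℝ E
  let S : Set (E →L[ℝ] E) := {A | ‖A‖ ≤ C ∧ A.det = 1}
  have hunit : ∀ A ∈ S, IsUnit A := by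
    rintro A ⟨-, hA⟩
    have h1 : LinearMap.det (A : E →ₗ[ℝ] E) = 1 := hA
    have h2 : IsUnit (A : E →ₗ[ℝ] E) := by
      rw [LinearMap.isUnit_iff_isUnit_det, h1]
      exact isUnit_one
    exact (ContinuousLinearMap.isUnit_iff_isUnit_toLinearMap).2 h2
  have hS : IsCompact S := by
    have : ProperSpace (E →L[ℝ] E) := FiniteDimensional.proper_real _
    refine (isCompact_closedBall (0 : E →L[ℝ] E) C).of_isClosed_subset ?_ ?_
    · exact (isClosed_le continuous_norm continuous_const).inter
        (isClosed_eq ContinuousLinearMap.continuous_det continuous_const)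
    · rintro A ⟨hA, -⟩
      exact mem_closedBall_zero_iff.2 hA
  -- Inversion is continuous at units, hence bounded on the compact set `S`.
  have hc : ContinuousOn (Ring.inverse : (E →L[ℝ] E) → (E →L[ℝ] E)) S := by
    intro A hA
    obtain ⟨u, rfl⟩ := hunit A hA
    exact (NormedRing.inverse_continuousAt u).continuousWithinAt
  obtain ⟨C', hC'⟩ := hS.exists_bound_of_continuousOn hc
  refine ⟨C', fun A B hA hdet hAB => ?_⟩
  obtain ⟨u, rfl⟩ := hunit A ⟨hA, hdet⟩
  have h1 : (u : E →L[ℝ] E) * B = 1 := hAB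
  have h2 : B = Ring.inverse (u : E →L[ℝ] E) := by
    rw [Ring.inverse_unit, ← mul_one (↑u⁻¹ : E →L[ℝ] E), ← h1, Units.inv_mul_cancel_left]
  rw [h2]
  exact hC' _ ⟨hA, hdet⟩

end InverseBound

/-! ### Geometry of the flow -/

namespace IsAdmissibleFlow

variable {d : ℕ} {Φ : ℝ → Space d → Space d}

theorem continuous_uncurry (hΦ : IsAdmissibleFlow Φ) :
    Continuous fun p : ℝ × Space d => Φ p.1 p.2 := hΦ.contDiff.continuous

theorem contDiff_apply (hΦ : IsAdmissibleFlow Φ) (τ : ℝ) : ContDiff ℝ 1 (Φ τ) :=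
  hΦ.contDiff.comp (contDiff_const.prodMk contDiff_id)

theorem differentiable (hΦ : IsAdmissibleFlow Φ) (τ : ℝ) : Differentiable ℝ (Φ τ) :=
  (hΦ.contDiff_apply τ).differentiable one_ne_zero

theorem det_fderiv (hΦ : IsAdmissibleFlow Φ) (τ : ℝ) (x : Space d) :
    (fderiv ℝ (Φ τ) x).det = 1 := by
  simpa [flowJacobian] using hΦ.volume_preserving (-τ) x

/-- The group law and the non-degeneracy of the derivative force `Φ₀ = id`. -/
theorem zero_apply (hΦ : IsAdmissibleFlow Φ) (x : Space d) : Φ 0 x = x := by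
  have hidem : ∀ x, Φ 0 (Φ 0 x) = Φ 0 x := fun x => by simpa using hΦ.group 0 0 x
  have hcl : IsClosed {x | Φ 0 x = x} := isClosed_eq (hΦ.contDiff_apply 0).continuous continuous_id
  -- Near a fixed point, `Φ 0` is injective by the inverse function theorem, and idempotence then
  -- gives `Φ 0 y = y`. Connectedness finishes, as `Φ 0 0` is fixed.
  have hop : IsOpen {x | Φ 0 x = x} := by
    rw [isOpen_iff_mem_nhds]
    intro x (hx : Φ 0 x = x)
    have hdet : (fderiv ℝ (Φ 0) x).det ≠ 0 := by
      rw [hΦ.det_fderiv]; exact one_ne_zero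
    let e : Space d ≃L[ℝ] Space d := (fderiv ℝ (Φ 0) x).toContinuousLinearEquivOfDetNeZero hdet
    have he : (e : Space d →L[ℝ] Space d) = fderiv ℝ (Φ 0) x := by
      simp only [e, ContinuousLinearMap.coe_toContinuousLinearEquivOfDetNeZero]
    have hs : HasStrictFDerivAt (Φ 0) (e : Space d →L[ℝ] Space d) x := by
      rw [he]
      exact (hΦ.contDiff_apply 0).contDiffAt.hasStrictFDerivAt one_ne_zero
    have hinv := hs.eventually_left_inverse
    have hc : Tendsto (Φ 0) (𝓝 x) (𝓝 x) := by
      simpa only [hx] using (hΦ.contDiff_apply 0).continuous.tendsto x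
    filter_upwards [hinv, hc.eventually hinv] with y h1 h2
    rw [hidem, h1] at h2
    exact h2.symm
  have huniv := IsClopen.eq_univ ⟨hcl, hop⟩ ⟨Φ 0 0, hidem 0⟩
  have : x ∈ {x | Φ 0 x = x} := by rw [huniv]; trivial
  exact this

theorem neg_apply_apply (hΦ : IsAdmissibleFlow Φ) (τ : ℝ) (x : Space d) :
    Φ (-τ) (Φ τ x) = x := by
  rw [hΦ.group, neg_add_cancel, hΦ.zero_apply]

theorem apply_neg_apply (hΦ : IsAdmissibleFlow Φ) (τ : ℝ) (x : Space d) :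
    Φ τ (Φ (-τ) x) = x := by
  rw [hΦ.group, add_neg_cancel, hΦ.zero_apply]

/-- A preimage under `Φ τ` is an image under the injective map `Φ (-τ)`, so the change of variables
formula with determinant one applies. -/
theorem measurePreserving (hΦ : IsAdmissibleFlow Φ) (τ : ℝ) :
    MeasurePreserving (Φ τ) volume volume := by
  refine ⟨(hΦ.contDiff_apply τ).continuous.measurable, ?_⟩
  ext s hs
  rw [Measure.map_apply (hΦ.contDiff_apply τ).continuous.measurable hs]
  have himg : Φ τ ⁻¹' s = Φ (-τ) '' s := by
    ext x
    constructor
    · exact fun hx => ⟨Φ τ x, hx, hΦ.neg_apply_apply τ x⟩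
    · rintro ⟨y, hy, rfl⟩
      rwa [mem_preimage, hΦ.apply_neg_apply]
  have hinj : InjOn (Φ (-τ)) s := fun x _ y _ hxy => by
    rw [← hΦ.apply_neg_apply τ x, hxy, hΦ.apply_neg_apply]
  rw [himg, ← lintegral_abs_det_fderiv_eq_addHaar_image volume hs
    (fun x _ => ((hΦ.differentiable (-τ)) x).hasFDerivAt.hasFDerivWithinAt) hinj]
  simp [hΦ.det_fderiv]

/-- Over a compact set, the derivatives of the flow maps are bounded at the inverse images too. -/
theorem exists_norm_fderiv_le (hΦ : IsAdmissibleFlow Φ) {K : Set (Space d)} (hK : IsCompact K) :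
    ∃ C : ℝ, ∀ (τ : ℝ) (x : Space d), Φ τ x ∈ K → ‖fderiv ℝ (Φ τ) x‖ ≤ C := by
  obtain ⟨C, hC⟩ := hΦ.jacobian_bounded K hK
  obtain ⟨C', hC'⟩ := exists_norm_inverse_le_of_det_eq_one (E := Space d) C
  refine ⟨C', fun τ x hx => ?_⟩
  -- Differentiating Φ_{-τ} ∘ Φ_τ = id shows that DΦ_τ(x) is a right inverse of J(τ, Φ_τ(x)), which
  -- is bounded since Φ_τ(x) lies in `K`.
  refine hC' (flowJacobian Φ τ (Φ τ x)) _ (hC _ hx τ) (hΦ.volume_preserving _ _) ?_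
  have h : (Φ (-τ)) ∘ (Φ τ) = id := funext fun y => hΦ.neg_apply_apply τ y
  rw [flowJacobian, ← fderiv_comp x ((hΦ.differentiable _) _) ((hΦ.differentiable _) _), h,
    fderiv_id]

end IsAdmissibleFlow

/-! ### Oscillatory integrals -/

section Oscillation

variable {d : ℕ}

theorem continuous_toTorus : Continuous (toTorus : Space d → UnitAddTorus (Fin d)) :=
  continuous_pi fun i => (AddCircle.continuous_mk' 1).comp (by fun_prop)

theorem norm_mFourier_apply (k : Fin d → ℤ) (y : UnitAddTorus (Fin d)) :
    ‖UnitAddTorus.mFourier k y‖ = 1 := by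
  simp only [UnitAddTorus.mFourier, ContinuousMap.coe_mk, norm_prod, fourier_apply,
    Circle.norm_coe, Finset.prod_const_one]

/-- The half period of a character in the direction of its frequency. -/
theorem exists_half_period {k : Fin d → ℤ} (hk : k ≠ 0) :
    ∃ h : Space d, ‖h‖ ≤ 1 ∧ ∀ x : Space d,
      UnitAddTorus.mFourier k (toTorus (x + h)) = -UnitAddTorus.mFourier k (toTorus x) := by
  obtain ⟨i, hi⟩ := Function.ne_iff.1 hk
  have hki : (k i : ℝ) ≠ 0 := by exact_mod_cast hi
  refine ⟨EuclideanSpace.single i (1 / (2 * (k i : ℝ))), ?_, fun x => ?_⟩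
  · rw [PiLp.norm_single, norm_div, norm_mul, norm_one, Real.norm_ofNat,
      div_le_one (by positivity)]
    have : (1 : ℝ) ≤ ‖(k i : ℝ)‖ := by
      rw [Real.norm_eq_abs, ← Int.cast_abs]
      exact_mod_cast Int.one_le_abs hi
    linarith
  · have hsplit : ∀ y : UnitAddTorus (Fin d), UnitAddTorus.mFourier k y
        = fourier (k i) (y i) * ∏ j ∈ Finset.univ.erase i, fourier (k j) (y j) := fun y =>
      (Finset.mul_prod_erase Finset.univ (fun j => fourier (k j) (y j)) (Finset.mem_univ i)).symm
    rw [hsplit, hsplit, ← neg_mul]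
    congr 1
    · have := fourier_add_half_inv_index (T := 1) hi one_pos (x i : UnitAddCircle)
      refine Eq.trans ?_ this
      congr 1
      simp only [toTorus, PiLp.add_apply, PiLp.single_apply, if_true,
        AddCircle.coe_add]
      congr 2
      field_simp
    · refine Finset.prod_congr rfl fun j hj => ?_
      have hji : j ≠ i := Finset.ne_of_mem_erase hj
      simp [toTorus, hji]

/-- An integral against a rapidly oscillating character is small, quantitatively in a Lipschitz
constant and the measure of the support. -/
theorem norm_integral_mul_mFourier_le {k : Fin d → ℤ} (hk : k ≠ 0) {g : Space d → ℂ}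
    (hg : Integrable g) {L : ℝ} (hL : ∀ x y, ‖g x - g y‖ ≤ L * ‖x - y‖) (hL0 : 0 ≤ L)
    {S : Set (Space d)} (hS : MeasurableSet S) (hSfin : volume S ≠ ⊤) (hgS : ∀ x ∉ S, g x = 0)
    {ε : ℝ} (hε : 0 < ε) :
    ‖∫ x, g x * UnitAddTorus.mFourier k (toTorus (ε⁻¹ • x))‖ ≤ L * ε * volume.real S := by
  obtain ⟨h, hh, hper⟩ := exists_half_period hk
  let e : Space d → ℂ := fun x => UnitAddTorus.mFourier k (toTorus (ε⁻¹ • x))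
  have hec : Continuous e :=
    (UnitAddTorus.mFourier k).continuous.comp (continuous_toTorus.comp (by fun_prop))
  have hen : ∀ x, ‖e x‖ = 1 := fun x => norm_mFourier_apply _ _
  have heper : ∀ x, e (x + ε • h) = -e x := fun x => by
    simp only [e, smul_add, smul_smul, inv_mul_cancel₀ hε.ne', one_smul]
    exact hper _
  have hint : Integrable fun x => g x * e x :=
    hg.mul_bdd (c := 1) hec.aestronglyMeasurable (Eventually.of_forall fun x => (hen x).le)
  have hgh : Integrable fun x => g (x + ε • h) := hg.comp_add_right _
  have hint' : Integrable fun x => g (x + ε • h) * e x :=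
    hgh.mul_bdd (c := 1) hec.aestronglyMeasurable (Eventually.of_forall fun x => (hen x).le)
  have h1 : ∫ x, g x * e x = -∫ x, g (x + ε • h) * e x := by
    rw [← integral_add_right_eq_self (fun x => g x * e x) (ε • h), ← integral_neg]
    simp only [heper, mul_neg]
  -- Averaging the integral with its half-period translate replaces `g` by a difference of size L ε.
  have h2 : 2 * ∫ x, g x * e x = ∫ x, (g x - g (x + ε • h)) * e x := by
    simp only [sub_mul]
    rw [integral_sub hint hint', two_mul]
    nth_rewrite 2 [h1]
    ring
  have hLε : 0 ≤ L * ε := by positivity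
  -- The difference is supported in the union of `S` and its translate; the resulting factor 2
  -- cancels the one on the left.
  let c : Space d → ℝ := fun x => L * ε * (S.indicator 1 x + S.indicator 1 (x + ε • h))
  have hSi : Integrable (S.indicator (1 : Space d → ℝ)) :=
    (integrable_indicator_iff hS).2 (integrableOn_const hSfin)
  have hc : Integrable c := (hSi.add (hSi.comp_add_right (ε • h))).const_mul _
  have hbound : ∀ x, ‖(g x - g (x + ε • h)) * e x‖ ≤ c x := by
    intro x
    rw [norm_mul, hen, mul_one]
    have hle : ‖g x - g (x + ε • h)‖ ≤ L * ε := by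
      refine (hL _ _).trans ?_
      rw [sub_add_cancel_left, norm_neg, norm_smul, Real.norm_of_nonneg hε.le]
      calc L * (ε * ‖h‖) ≤ L * (ε * 1) := by gcongr
        _ = L * ε := by ring
    by_cases hx : x ∈ S
    · have : (0 : ℝ) ≤ S.indicator 1 (x + ε • h) := indicator_nonneg (fun _ _ => zero_le_one) _
      simp only [c, indicator_of_mem hx, Pi.one_apply]
      nlinarith
    · by_cases hy : x + ε • h ∈ S
      · simpa [c, indicator_of_mem hy, indicator_of_notMem hx] using hle
      · simp [c, hgS x hx, hgS _ hy, indicator_of_notMem hx, indicator_of_notMem hy]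
  have hci : ∫ x, c x = L * ε * (volume.real S + volume.real S) := by
    simp only [c]
    rw [integral_const_mul, integral_add hSi (hSi.comp_add_right (ε • h)),
      integral_add_right_eq_self (S.indicator (1 : Space d → ℝ)) (ε • h),
      integral_indicator_one hS]
  have h3 := norm_integral_le_of_norm_le hc (Eventually.of_forall hbound)
  rw [← h2, hci, norm_mul, Complex.norm_ofNat] at h3
  linarith

/-- Oscillating integrals of a smooth amplitude transported by the flow are small, uniformly in
the time of the flow. -/
theorem IsAdmissibleFlow.exists_norm_integral_mul_mFourier_le {Φ : ℝ → Space d → Space d}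
    (hΦ : IsAdmissibleFlow Φ) {k : Fin d → ℤ} (hk : k ≠ 0) {K : Set (Space d)}
    (hK : IsCompact K) {M : ℝ} (hM : 0 ≤ M) :
    ∃ C : ℝ, ∀ (θ : Space d → ℂ), ContDiff ℝ 1 θ → tsupport θ ⊆ K → (∀ x, ‖fderiv ℝ θ x‖ ≤ M) →
      ∀ (τ ε : ℝ), 0 < ε →
        ‖∫ x, θ (Φ τ x) * UnitAddTorus.mFourier k (toTorus (ε⁻¹ • x))‖ ≤ C * ε := by
  obtain ⟨C, hC⟩ := hΦ.exists_norm_fderiv_le hK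
  refine ⟨M * max C 0 * volume.real K, fun θ hθ hsupp hθM τ ε hε => ?_⟩
  have hθd : Differentiable ℝ θ := hθ.differentiable one_ne_zero
  have hgd : Differentiable ℝ (θ ∘ Φ τ) := hθd.comp (hΦ.differentiable τ)
  have hfd : ∀ x, ‖fderiv ℝ (θ ∘ Φ τ) x‖ ≤ M * max C 0 := by
    intro x
    rw [fderiv_comp x (hθd _) (hΦ.differentiable τ x)]
    by_cases hx : Φ τ x ∈ K
    · refine (ContinuousLinearMap.opNorm_comp_le _ _).trans ?_
      exact mul_le_mul (hθM _) ((hC τ x hx).trans (le_max_left _ _)) (norm_nonneg _) hM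
    · have : fderiv ℝ θ (Φ τ x) = 0 :=
        fderiv_of_notMem_tsupport _ fun h => hx (hsupp h)
      rw [this, ContinuousLinearMap.zero_comp, norm_zero]
      positivity
  have hcs : HasCompactSupport θ := hK.of_isClosed_subset (isClosed_tsupport θ) hsupp
  have hmp := hΦ.measurePreserving τ
  have hint : Integrable (θ ∘ Φ τ) :=
    hmp.integrable_comp_of_integrable (hθ.continuous.integrable_of_hasCompactSupport hcs)
  -- The transported support depends on τ, but its volume does not.
  have hvol : volume (Φ τ ⁻¹' K) = volume K :=
    hmp.measure_preimage hK.measurableSet.nullMeasurableSet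
  have := norm_integral_mul_mFourier_le hk hint (L := M * max C 0) (fun x y =>
    Convex.norm_image_sub_le_of_norm_fderiv_le (fun z _ => hgd z) (fun z _ => hfd z) convex_univ
      (mem_univ y) (mem_univ x)) (by positivity) (hmp.measurable hK.measurableSet)
    (by rw [hvol]; exact hK.measure_lt_top.ne) (fun x hx => by
      by_contra h
      exact hx (hsupp (subset_tsupport θ h))) hε
  rw [measureReal_def, hvol, ← measureReal_def] at this
  refine this.trans_eq (by ring)

end Oscillation

/-! ### Straightening the flow in space-time -/

section SpaceTime

variable {d : ℕ} {T : ℝ}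

theorem spaceTimeMeasure_eq_prod (d : ℕ) (T : ℝ) :
    spaceTimeMeasure d T = (volume.restrict (Ioo 0 T)).prod (volume : Measure (Space d)) := by
  rw [spaceTimeMeasure, Measure.volume_eq_prod, ← Measure.prod_restrict, Measure.restrict_univ]

instance : IsFiniteMeasureOnCompacts (spaceTimeMeasure d T) := by
  unfold spaceTimeMeasure; infer_instance

instance : SFinite (spaceTimeMeasure d T) := by
  unfold spaceTimeMeasure; infer_instance

/-- The map `(t, x) ↦ (t, Φ_{-t/ε}(x))` that straightens the flow. -/
noncomputable def flowPullback (Φ : ℝ → Space d → Space d) (ε : ℝ) (p : ℝ × Space d) : ℝ × Space d :=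
  (p.1, Φ (-p.1 / ε) p.2)

variable {Φ : ℝ → Space d → Space d}

theorem IsAdmissibleFlow.continuous_flowPullback (hΦ : IsAdmissibleFlow Φ) (ε : ℝ) :
    Continuous (flowPullback Φ ε) := by
  refine continuous_fst.prodMk (hΦ.continuous_uncurry.comp
    (f := fun p : ℝ × Space d => (-p.1 / ε, p.2)) (by fun_prop))

theorem IsAdmissibleFlow.measurePreserving_flowPullback (hΦ : IsAdmissibleFlow Φ) (ε : ℝ) :
    MeasurePreserving (flowPullback Φ ε) (spaceTimeMeasure d T) (spaceTimeMeasure d T) := by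
  rw [spaceTimeMeasure_eq_prod]
  exact (MeasurePreserving.id _).skew_product (g := fun t x => Φ (-t / ε) x)
    (hΦ.continuous_flowPullback ε).snd.measurable
    (Eventually.of_forall fun t => (hΦ.measurePreserving _).map_eq)

end SpaceTime

/-! ### Limits of oscillating integrals -/

section MeanValue

variable {d : ℕ} {T : ℝ} {Φ : ℝ → Space d → Space d}

/-- Integrating out x leaves an integrable function of t, extended by zero outside (0,T), against
which the weak-* mean value is tested. -/
theorem tendsto_integral_mul_rescale (A : AlgebraWithMeanValue) (f : A.Alg)
    {w : ℝ × Space d → ℂ} (hw : Integrable w (spaceTimeMeasure d T)) :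
    Tendsto (fun ε : ℝ => ∫ p, w p * f.1 (p.1 / ε) ∂spaceTimeMeasure d T) (𝓝[>] 0)
      (𝓝 (A.mean f * ∫ p, w p ∂spaceTimeMeasure d T)) := by
  have hw' := hw
  rw [spaceTimeMeasure_eq_prod] at hw' ⊢
  have hg : Integrable ((Ioo 0 T).indicator fun t => ∫ x, w (t, x)) :=
    (integrable_indicator_iff measurableSet_Ioo).2 hw'.integral_prod_left
  have h := A.hasMeanValue_mean f _ hg
  rw [integral_const_mul, integral_indicator measurableSet_Ioo, ← integral_prod w hw'] at h
  refine h.congr fun ε => ?_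
  have hi : Integrable (fun p : ℝ × Space d => w p * f.1 (p.1 / ε))
      ((volume.restrict (Ioo 0 T)).prod volume) :=
    hw'.mul_bdd (c := ‖f.1‖) (f.1.continuous.comp (by fun_prop)).aestronglyMeasurable
      (Eventually.of_forall fun p => f.1.norm_coe_le_norm _)
  rw [integral_prod _ hi, ← integral_indicator measurableSet_Ioo]
  congr 1
  ext t
  by_cases ht : t ∈ Ioo 0 T
  · simp only [indicator_of_mem ht]
    rw [integral_mul_const, mul_comm]
  · simp [indicator_of_notMem ht]

/-- The straightening preserves the measure and the time coordinate, so it drops out. -/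
theorem IsAdmissibleFlow.tendsto_integral_mul_rescale (hΦ : IsAdmissibleFlow Φ)
    (A : AlgebraWithMeanValue) (f : A.Alg)
    {w : ℝ × Space d → ℂ} (hw : Integrable w (spaceTimeMeasure d T)) :
    Tendsto (fun ε : ℝ => ∫ p, w (flowPullback Φ ε p) * f.1 (p.1 / ε) ∂spaceTimeMeasure d T)
      (𝓝[>] 0) (𝓝 (A.mean f * ∫ p, w p ∂spaceTimeMeasure d T)) := by
  refine (_root_.tendsto_integral_mul_rescale A f hw).congr fun ε => ?_
  have hG := hΦ.measurePreserving_flowPullback (T := T) ε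
  have hc : Continuous fun p : ℝ × Space d => f.1 (p.1 / ε) :=
    f.1.continuous.comp (by fun_prop)
  have hm : AEStronglyMeasurable (fun p : ℝ × Space d => w p * f.1 (p.1 / ε))
      (Measure.map (flowPullback Φ ε) (spaceTimeMeasure d T)) := by
    rw [hG.map_eq]
    exact hw.aestronglyMeasurable.mul hc.aestronglyMeasurable
  have := integral_map hG.measurable.aemeasurable hm
  rw [hG.map_eq] at this
  exact this

/-- The oscillating factor `f(t/ε) e_k(x/ε)`. -/
noncomputable def oscillatingFactor {A : AlgebraWithMeanValue} (f : A.Alg) (k : Fin d → ℤ) (ε : ℝ)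
    (p : ℝ × Space d) : ℂ :=
  f.1 (p.1 / ε) * UnitAddTorus.mFourier k (toTorus (ε⁻¹ • p.2))

theorem continuous_oscillatingFactor {A : AlgebraWithMeanValue} (f : A.Alg) (k : Fin d → ℤ) (ε : ℝ) :
    Continuous (oscillatingFactor f k ε) :=
  (f.1.continuous.comp (by fun_prop)).mul
    ((UnitAddTorus.mFourier k).continuous.comp (continuous_toTorus.comp (by fun_prop)))

theorem norm_oscillatingFactor_le {A : AlgebraWithMeanValue} (f : A.Alg) (k : Fin d → ℤ) (ε : ℝ)
    (p : ℝ × Space d) : ‖oscillatingFactor f k ε p‖ ≤ ‖f.1‖ := by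
  rw [oscillatingFactor, norm_mul, norm_mFourier_apply, mul_one]
  exact f.1.norm_coe_le_norm _

/-- At fixed t the factor f(t/ε) is constant in x, and the spatial bound applies with the same
compact set and derivative bound for every t. -/
theorem IsAdmissibleFlow.exists_norm_integral_mul_oscillatingFactor_le (hΦ : IsAdmissibleFlow Φ)
    {A : AlgebraWithMeanValue} (f : A.Alg) {k : Fin d → ℤ} (hk : k ≠ 0)
    {w : ℝ × Space d → ℂ} (hw : ContDiff ℝ 1 w) (hwc : HasCompactSupport w) :
    ∃ C : ℝ, ∀ ε : ℝ, 0 < ε →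
      ‖∫ p, w (flowPullback Φ ε p) * oscillatingFactor f k ε p ∂spaceTimeMeasure d T‖ ≤ C * ε := by
  obtain ⟨M, hM⟩ := (hw.continuous_fderiv one_ne_zero).bounded_above_of_compact_support
    (hwc.fderiv (𝕜 := ℝ))
  have hM0 : 0 ≤ M := (norm_nonneg _).trans (hM 0)
  let K : Set (Space d) := Prod.snd '' tsupport w
  have hK : IsCompact K := hwc.isCompact.image continuous_snd
  obtain ⟨C, hC⟩ := hΦ.exists_norm_integral_mul_mFourier_le hk hK hM0
  refine ⟨‖f.1‖ * C * volume.real (Ioo 0 T), fun ε hε => ?_⟩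
  have hint : Integrable (fun p => w (flowPullback Φ ε p) * oscillatingFactor f k ε p)
      (spaceTimeMeasure d T) :=
    ((hΦ.measurePreserving_flowPullback ε).integrable_comp_of_integrable
      (hw.continuous.integrable_of_hasCompactSupport hwc)).mul_bdd (c := ‖f.1‖)
      (continuous_oscillatingFactor f k ε).aestronglyMeasurable
      (Eventually.of_forall fun p => norm_oscillatingFactor_le f k ε p)
  rw [spaceTimeMeasure_eq_prod] at hint ⊢
  rw [integral_prod _ hint]
  have hbound : ∀ t : ℝ, ‖∫ x, w (flowPullback Φ ε (t, x)) * oscillatingFactor f k ε (t, x)‖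
      ≤ ‖f.1‖ * (C * ε) := by
    intro t
    have hslice : ContDiff ℝ 1 fun x => w (t, x) := hw.comp (contDiff_const.prodMk contDiff_id)
    have hsupp : tsupport (fun x => w (t, x)) ⊆ K :=
      closure_minimal (fun x hx => ⟨(t, x), subset_tsupport w hx, rfl⟩) hK.isClosed
    have hder : ∀ x, ‖fderiv ℝ (fun x => w (t, x)) x‖ ≤ M := by
      intro x
      have h1 : HasFDerivAt (fun x => w (t, x))
          ((fderiv ℝ w (t, x)).comp (ContinuousLinearMap.inr ℝ ℝ (Space d))) x :=
        ((hw.differentiable one_ne_zero) (t, x)).hasFDerivAt.comp x (hasFDerivAt_prodMk_right t x)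
      rw [h1.fderiv]
      refine (ContinuousLinearMap.opNorm_comp_le _ _).trans ?_
      calc _ ≤ M * 1 := mul_le_mul (hM _) (ContinuousLinearMap.norm_inr_le_one _ _ _)
            (norm_nonneg _) hM0
        _ = M := mul_one M
    have h2 := hC _ hslice hsupp hder (-t / ε) ε hε
    have h3 : ∫ x, w (flowPullback Φ ε (t, x)) * oscillatingFactor f k ε (t, x)
        = f.1 (t / ε) * ∫ x, w (t, Φ (-t / ε) x)
          * UnitAddTorus.mFourier k (toTorus (ε⁻¹ • x)) := by
      rw [← integral_const_mul]
      refine integral_congr_ae (Eventually.of_forall fun x => ?_)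
      simp only [flowPullback, oscillatingFactor]
      ring
    rw [h3, norm_mul]
    exact mul_le_mul (f.1.norm_coe_le_norm _) h2 (norm_nonneg _) (norm_nonneg _)
  refine (norm_setIntegral_le_of_norm_le_const (by simp) fun t _ => hbound t).trans_eq ?_
  ring

/-- Smooth compactly supported functions are dense in L¹, and the approximation error is uniform in
ε because the straightening preserves the measure. -/
theorem IsAdmissibleFlow.tendsto_integral_mul_oscillatingFactor (hΦ : IsAdmissibleFlow Φ)
    {A : AlgebraWithMeanValue} (f : A.Alg) {k : Fin d → ℤ} (hk : k ≠ 0)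
    {w : ℝ × Space d → ℂ} (hw : Integrable w (spaceTimeMeasure d T)) :
    Tendsto (fun ε : ℝ => ∫ p, w (flowPullback Φ ε p) * oscillatingFactor f k ε p ∂spaceTimeMeasure d T)
      (𝓝[>] 0) (𝓝 0) := by
  have hI : ∀ {v : ℝ × Space d → ℂ}, Integrable v (spaceTimeMeasure d T) → ∀ ε : ℝ,
      Integrable (fun p => v (flowPullback Φ ε p) * oscillatingFactor f k ε p)
        (spaceTimeMeasure d T) := fun hv ε =>
    ((hΦ.measurePreserving_flowPullback ε).integrable_comp_of_integrable hv).mul_bdd (c := ‖f.1‖)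
      (continuous_oscillatingFactor f k ε).aestronglyMeasurable
      (Eventually.of_forall fun p => norm_oscillatingFactor_le f k ε p)
  rw [Metric.tendsto_nhds]
  intro δ hδ
  let η : ℝ := δ / (2 * (‖f.1‖ + 1))
  have hη : 0 < η := by positivity
  obtain ⟨v, hvc, hv, hvw⟩ := (memLp_one_iff_integrable.2 hw).exist_eLpNorm_sub_le
    ENNReal.one_ne_top le_rfl hη
  have hvi : Integrable v (spaceTimeMeasure d T) :=
    hv.continuous.integrable_of_hasCompactSupport hvc
  obtain ⟨C, hC⟩ := hΦ.exists_norm_integral_mul_oscillatingFactor_le (T := T) f hk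
    (hv.of_le (by simp)) hvc
  have hsmall : ∀ᶠ ε : ℝ in 𝓝[>] 0, C * ε < δ / 2 := by
    have : Tendsto (fun ε : ℝ => C * ε) (𝓝[>] 0) (𝓝 (C * 0)) :=
      (continuous_const.mul continuous_id).continuousAt.tendsto.mono_left nhdsWithin_le_nhds
    rw [mul_zero] at this
    exact this.eventually_lt_const (by positivity)
  filter_upwards [hsmall, self_mem_nhdsWithin] with ε h1 hε
  rw [dist_zero_right]
  have h2 := hC ε hε
  have h3 : ∫ p, w (flowPullback Φ ε p) * oscillatingFactor f k ε p ∂spaceTimeMeasure d T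
      = ∫ p, (w - v) (flowPullback Φ ε p) * oscillatingFactor f k ε p ∂spaceTimeMeasure d T
        + ∫ p, v (flowPullback Φ ε p) * oscillatingFactor f k ε p ∂spaceTimeMeasure d T := by
    rw [← integral_add (hI (hw.sub hvi) ε) (hI hvi ε)]
    simp [sub_mul]
  have hG := hΦ.measurePreserving_flowPullback (T := T) ε
  have h4 : ‖∫ p, (w - v) (flowPullback Φ ε p) * oscillatingFactor f k ε p ∂spaceTimeMeasure d T‖
      ≤ η * ‖f.1‖ := by
    have hn := (hG.integrable_comp_of_integrable (hw.sub hvi)).norm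
    refine (norm_integral_le_of_norm_le (hn.mul_const ‖f.1‖) (Eventually.of_forall fun p => by
      rw [norm_mul]
      exact mul_le_mul_of_nonneg_left (norm_oscillatingFactor_le f k ε p) (norm_nonneg _))).trans ?_
    rw [integral_mul_const]
    refine mul_le_mul_of_nonneg_right ?_ (norm_nonneg _)
    have hm : AEStronglyMeasurable (fun p => ‖(w - v) p‖)
        (Measure.map (flowPullback Φ ε) (spaceTimeMeasure d T)) := by
      rw [hG.map_eq]
      exact (hw.sub hvi).aestronglyMeasurable.norm
    have h5 := integral_map hG.measurable.aemeasurable hm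
    rw [hG.map_eq] at h5
    change ∫ p, ‖(w - v) (flowPullback Φ ε p)‖ ∂spaceTimeMeasure d T ≤ η
    rw [← h5, integral_norm_eq_lintegral_enorm (hw.sub hvi).aestronglyMeasurable,
      ← eLpNorm_one_eq_lintegral_enorm]
    exact ENNReal.toReal_le_of_le_ofReal hη.le hvw
  have h6 : η * ‖f.1‖ ≤ δ / 2 := by
    have : η * (‖f.1‖ + 1) = δ / 2 := by simp only [η]; field_simp
    nlinarith
  rw [h3]
  exact (norm_add_le _ _).trans_lt (by linarith)

theorem IsAdmissibleFlow.tendsto_integral_mul_oscillatingFactor_ite (hΦ : IsAdmissibleFlow Φ)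
    {A : AlgebraWithMeanValue} (f : A.Alg) (k : Fin d → ℤ)
    {w : ℝ × Space d → ℂ} (hw : Integrable w (spaceTimeMeasure d T)) :
    Tendsto (fun ε : ℝ => ∫ p, w (flowPullback Φ ε p) * oscillatingFactor f k ε p ∂spaceTimeMeasure d T)
      (𝓝[>] 0) (𝓝 ((∫ p, w p ∂spaceTimeMeasure d T) * (A.mean f * if k = 0 then 1 else 0))) := by
  by_cases hk : k = 0
  · simpa [oscillatingFactor, hk, UnitAddTorus.mFourier_zero, mul_comm (A.mean f)] using
      hΦ.tendsto_integral_mul_rescale A f hw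
  · simpa [hk] using hΦ.tendsto_integral_mul_oscillatingFactor f hk hw

end MeanValue

/-! ### The product algebra and its evaluations -/

namespace AlgebraWithMeanValue

variable (A : AlgebraWithMeanValue) {d : ℕ}

/-- The product `f(τ) g(y)`, as an element of `A ⊙ C(𝕋^d)`. -/
noncomputable def tensor (f : A.Alg) (g : C(Torus d, ℂ)) : A.productAlgebra d :=
  ⟨BoundedContinuousFunction.ofNormedAddCommGroup (fun p => f.1 p.1 * g p.2)
      ((f.1.continuous.comp continuous_fst).mul (g.continuous.comp continuous_snd))
      (‖f.1‖ * ‖g‖) fun p => by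
        rw [norm_mul]
        exact mul_le_mul (f.1.norm_coe_le_norm _) (g.norm_coe_le_norm _) (norm_nonneg _)
          (norm_nonneg _),
    Submodule.le_topologicalClosure _ (Submodule.subset_span ⟨f, g, fun _ _ => rfl⟩)⟩

theorem tensor_apply (f : A.Alg) (g : C(Torus d, ℂ)) (p : ℝ × Torus d) :
    (A.tensor f g).1 p = f.1 p.1 * g p.2 := rfl

theorem norm_tensor_le (f : A.Alg) (g : C(Torus d, ℂ)) : ‖A.tensor f g‖ ≤ ‖f.1‖ * ‖g‖ :=
  (BoundedContinuousFunction.norm_le (by positivity)).2 fun p => by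
    change ‖f.1 p.1 * g p.2‖ ≤ _
    rw [norm_mul]
    exact mul_le_mul (f.1.norm_coe_le_norm _) (g.norm_coe_le_norm _) (norm_nonneg _)
      (norm_nonneg _)

/-- The product with a fixed element of `A`, as an operator. -/
noncomputable def tensorCLM (f : A.Alg) : C(Torus d, ℂ) →L[ℂ] A.productAlgebra d :=
  LinearMap.mkContinuous
    { toFun := A.tensor f
      map_add' := fun g h => by
        ext p
        exact mul_add _ _ _
      map_smul' := fun c g => by
        ext p
        exact mul_left_comm _ _ _ }
    ‖f.1‖ (A.norm_tensor_le f)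

/-- Trigonometric polynomials are dense in C(𝕋^d), which yields all products f(τ) g(y); these span a
dense subspace by construction. -/
theorem eq_top_of_tensor_mFourier_mem {V : Submodule ℂ (A.productAlgebra d)}
    (hV : IsClosed (V : Set (A.productAlgebra d)))
    (h : ∀ f k, A.tensor f (UnitAddTorus.mFourier k) ∈ V) : V = ⊤ := by
  have hten : ∀ f g, A.tensor f g ∈ V := by
    intro f g
    have h1 : V.comap (A.tensorCLM (d := d) f).toLinearMap = ⊤ := by
      rw [eq_top_iff, ← UnitAddTorus.span_mFourier_closure_eq_top]
      refine Submodule.topologicalClosure_minimal _ (Submodule.span_le.2 ?_)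
        (hV.preimage (A.tensorCLM (d := d) f).continuous)
      rintro _ ⟨k, rfl⟩
      exact h f k
    have h2 : g ∈ V.comap (A.tensorCLM (d := d) f).toLinearMap := by
      rw [h1]; trivial
    exact h2
  have hcl : IsClosed ((V.map (A.productAlgebra d).subtype : Submodule ℂ _) :
      Set ((ℝ × Torus d) →ᵇ ℂ)) := by
    have hE : IsClosed (A.productAlgebra d : Set ((ℝ × Torus d) →ᵇ ℂ)) :=
      Submodule.isClosed_topologicalClosure _
    rw [Submodule.map_coe]
    exact hE.isClosedEmbedding_subtypeVal.isClosedMap _ hV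
  have hle : A.productAlgebra d ≤ V.map (A.productAlgebra d).subtype := by
    refine Submodule.topologicalClosure_minimal _ (Submodule.span_le.2 ?_) hcl
    rintro F ⟨f, g, hF⟩
    exact ⟨A.tensor f g, hten f g, by ext p; exact (hF p.1 p.2).symm⟩
  rw [eq_top_iff]
  rintro ⟨F, hF⟩ -
  obtain ⟨F', hF', rfl⟩ := hle hF
  exact hF'

theorem norm_gelfandHat_le (F : A.productAlgebra d) (q : A.Spectrum × Torus d) :
    ‖A.gelfandHat F q‖ ≤ ‖F‖ := by
  refine (spectrum.norm_le_norm_of_mem (AlgHom.apply_mem_spectrum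
    (WeakDual.CharacterSpace.toAlgHom q.1)
    (⟨slice F.1 q.2, A.slice_mem F q.2⟩ : A.Alg))).trans ?_
  exact (BoundedContinuousFunction.norm_le (norm_nonneg _)).2 fun τ => F.1.norm_coe_le_norm _

/-- The evaluation `F ↦ F̂(s, y)`. -/
noncomputable def gelfandEval (q : A.Spectrum × Torus d) : A.productAlgebra d →L[ℂ] ℂ :=
  LinearMap.mkContinuous
    { toFun := fun F => A.gelfandHat F q
      map_add' := fun F G => map_add q.1 (⟨slice F.1 q.2, A.slice_mem F q.2⟩ : A.Alg)
        ⟨slice G.1 q.2, A.slice_mem G q.2⟩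
      map_smul' := fun c F => map_smul q.1 c (⟨slice F.1 q.2, A.slice_mem F q.2⟩ : A.Alg) }
    1 fun F => (A.norm_gelfandHat_le F q).trans_eq (one_mul _).symm

theorem gelfandEval_apply (q : A.Spectrum × Torus d) (F : A.productAlgebra d) :
    A.gelfandEval q F = A.gelfandHat F q := rfl

theorem norm_gelfandEval_le (q : A.Spectrum × Torus d) : ‖A.gelfandEval q‖ ≤ 1 :=
  LinearMap.mkContinuous_norm_le _ zero_le_one _

theorem gelfandHat_tensor (f : A.Alg) (g : C(Torus d, ℂ)) (q : A.Spectrum × Torus d) :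
    A.gelfandHat (A.tensor f g) q = q.1 f * g q.2 := by
  have h : (⟨slice (A.tensor f g).1 q.2, A.slice_mem (A.tensor f g) q.2⟩ : A.Alg)
      = g q.2 • f := by
    ext τ
    exact mul_comm _ _
  change q.1 (⟨slice (A.tensor f g).1 q.2, A.slice_mem (A.tensor f g) q.2⟩ : A.Alg) = _
  rw [h, map_smul, smul_eq_mul, mul_comm]

/-- Measurability survives sums, multiples and norm limits, so the products f(τ) e_k(y) suffice. -/
theorem measurable_gelfandHat (F : A.productAlgebra d) : Measurable (A.gelfandHat F) := by
  let V : Submodule ℂ (A.productAlgebra d) :=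
    { carrier := {F | Measurable fun q => A.gelfandEval q F}
      add_mem' := fun {F G} hF hG => by
        simp only [mem_ofPred_eq, map_add] at hF hG ⊢
        exact hF.add hG
      zero_mem' := by simp
      smul_mem' := fun c F hF => by
        simp only [mem_ofPred_eq, map_smul] at hF ⊢
        exact hF.const_smul c }
  have hV : IsClosed (V : Set (A.productAlgebra d)) := by
    refine IsSeqClosed.isClosed fun G F hG hGF => ?_
    refine measurable_of_tendsto_metrizable (f := fun n q => A.gelfandEval q (G n)) hG ?_
    rw [tendsto_pi_nhds]
    exact fun q => ((A.gelfandEval q).continuous.tendsto _).comp hGF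
  have htop := A.eq_top_of_tensor_mFourier_mem hV fun f k => by
    change Measurable fun q => A.gelfandEval q _
    simp only [gelfandEval_apply, gelfandHat_tensor]
    have h1 : Measurable fun s : A.Spectrum => s f :=
      (WeakDual.gelfandTransform ℂ A.Alg f).continuous.measurable
    exact (h1.comp measurable_fst).mul
      ((UnitAddTorus.mFourier k).continuous.measurable.comp measurable_snd)
  have : F ∈ V := by rw [htop]; trivial
  exact this

theorem apply_star_mul (s : A.Spectrum) (f g : A.Alg) :
    s (star f * g) = (starRingEnd ℂ) (s f) * s g := by
  rw [map_mul, map_star]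
  rfl

/-- The evaluation of an element of `A ⊙ C(𝕋^d)` at `(t/ε, x/ε)`. -/
noncomputable def rescaledEval (ε : ℝ) (p : ℝ × Space d) : A.productAlgebra d →L[ℂ] ℂ :=
  (BoundedContinuousFunction.evalCLM ℂ (p.1 / ε, toTorus (ε⁻¹ • p.2))).comp
    (A.productAlgebra d).subtypeL

theorem rescaledEval_apply (ε : ℝ) (p : ℝ × Space d) (F : A.productAlgebra d) :
    A.rescaledEval ε p F = F.1 (p.1 / ε, toTorus (ε⁻¹ • p.2)) := rfl

theorem norm_rescaledEval_le (ε : ℝ) (p : ℝ × Space d) : ‖A.rescaledEval ε p‖ ≤ 1 :=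
  ContinuousLinearMap.opNorm_le_bound _ zero_le_one fun F =>
    (F.1.norm_coe_le_norm _).trans_eq (one_mul _).symm

theorem measurable_rescaledEval (ε : ℝ) (F : A.productAlgebra d) :
    Measurable fun p : ℝ × Space d => A.rescaledEval ε p F :=
  (F.1.continuous.comp (Continuous.prodMk (by fun_prop)
    (continuous_toTorus.comp (by fun_prop)))).measurable

end AlgebraWithMeanValue

/-! ### Integrals of characters on the torus -/

instance : IsProbabilityMeasure (volume : Measure UnitAddCircle) :=
  ⟨UnitAddCircle.measure_univ⟩

theorem integral_fourier (n : ℤ) :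
    ∫ y : UnitAddCircle, fourier n y = if n = 0 then (1 : ℂ) else 0 := by
  have h := orthonormal_iff_ite.1 (orthonormal_fourier (T := 1)) 0 n
  rw [fourierLp, fourierLp, ContinuousMap.inner_toLp] at h
  rw [AddCircle.volume_eq_smul_haarAddCircle, ENNReal.ofReal_one, one_smul]
  simpa [eq_comm] using h

theorem integral_mFourier {d : ℕ} (k : Fin d → ℤ) :
    ∫ y, UnitAddTorus.mFourier k y = if k = 0 then (1 : ℂ) else 0 := by
  have h : ∫ y, UnitAddTorus.mFourier k y = ∏ i, ∫ y : UnitAddCircle, fourier (k i) y :=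
    integral_fintype_prod_volume_eq_prod fun i (y : UnitAddCircle) => fourier (k i) y
  simp only [h, integral_fourier]
  by_cases hk : k = 0
  · simp [hk]
  · obtain ⟨i, hi⟩ := Function.ne_iff.1 hk
    rw [if_neg hk]
    exact Finset.prod_eq_zero (Finset.mem_univ i) (if_neg hi)

/-! ### The two operators and convergence of their norms -/

section Operators

variable (A : AlgebraWithMeanValue) {d : ℕ} (T : ℝ)

theorem measurePreserving_fst_limitMeasure :
    MeasurePreserving Prod.fst (limitMeasure A d T) (spaceTimeMeasure d T) :=
  measurePreserving_fst

/-- The operator `ψ ↦ ψ̂`. -/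
noncomputable def gelfandOp :
    Lp (A.productAlgebra d) 2 (spaceTimeMeasure d T) →L[ℂ] Lp ℂ 2 (limitMeasure A d T) :=
  evalOp (fun q => A.gelfandEval q.2)
    (fun F => (A.measurable_gelfandHat F).comp measurable_snd)
    (fun q => A.norm_gelfandEval_le q.2) Prod.fst (measurePreserving_fst_limitMeasure A T)

variable {A T} in
theorem coeFn_gelfandOp_toLp {ψ : ℝ × Space d → A.productAlgebra d}
    (hψ : MemLp ψ 2 (spaceTimeMeasure d T)) :
    gelfandOp A T hψ.toLp =ᵐ[limitMeasure A d T] fun q => A.gelfandHat (ψ q.1) q.2 :=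
  coeFn_evalOp_toLp _ _ _ hψ

variable {Φ : ℝ → Space d → Space d}

/-- The operator that maps `ψ` to `ψ(t, Φ_{-t/ε}(x), t/ε, x/ε)`. -/
noncomputable def traceOp (hΦ : IsAdmissibleFlow Φ) (ε : ℝ) :
    Lp (A.productAlgebra d) 2 (spaceTimeMeasure d T) →L[ℂ] Lp ℂ 2 (spaceTimeMeasure d T) :=
  evalOp (A.rescaledEval ε) (A.measurable_rescaledEval ε) (A.norm_rescaledEval_le ε)
    (flowPullback Φ ε) (hΦ.measurePreserving_flowPullback ε)

variable {A T} in
theorem coeFn_traceOp_toLp (hΦ : IsAdmissibleFlow Φ) (ε : ℝ)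
    {ψ : ℝ × Space d → A.productAlgebra d} (hψ : MemLp ψ 2 (spaceTimeMeasure d T)) :
    traceOp A T hΦ ε hψ.toLp =ᵐ[spaceTimeMeasure d T] fun p =>
      (ψ (p.1, Φ (-p.1 / ε) p.2)).1 (p.1 / ε, toTorus (ε⁻¹ • p.2)) :=
  coeFn_evalOp_toLp _ _ _ hψ

variable {A T}

theorem indicator_mul_indicator_const (s s' : Set (ℝ × Space d)) (F F' : A.productAlgebra d)
    (l : A.productAlgebra d →L[ℂ] ℂ) (p : ℝ × Space d) :
    inner ℂ (l (s'.indicator (fun _ => F') p)) (l (s.indicator (fun _ => F) p))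
      = (s ∩ s').indicator (fun _ => (1 : ℂ)) p * ((starRingEnd ℂ) (l F') * l F) := by
  by_cases hs : p ∈ s <;> by_cases hs' : p ∈ s' <;> simp [hs, hs', mul_comm]

theorem conj_mFourier_mul (k k' : Fin d → ℤ) (y : UnitAddTorus (Fin d)) :
    (starRingEnd ℂ) (UnitAddTorus.mFourier k' y) * UnitAddTorus.mFourier k y
      = UnitAddTorus.mFourier (k - k') y := by
  rw [← UnitAddTorus.mFourier_neg, ← UnitAddTorus.mFourier_add, sub_eq_add_neg, add_comm]

/-- The limit measure is a product, so the integral factors: β yields the mean value, and the torus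
yields Fourier orthogonality. -/
theorem inner_gelfandOp_indicator {s s' : Set (ℝ × Space d)} (hs : MeasurableSet s)
    (hs' : MeasurableSet s') (hsf : spaceTimeMeasure d T s ≠ ⊤)
    (hsf' : spaceTimeMeasure d T s' ≠ ⊤) (f f' : A.Alg) (k k' : Fin d → ℤ) :
    inner ℂ (gelfandOp A T (indicatorConstLp 2 hs' hsf' (A.tensor f' (UnitAddTorus.mFourier k'))))
        (gelfandOp A T (indicatorConstLp 2 hs hsf (A.tensor f (UnitAddTorus.mFourier k))))
      = (∫ p, (s ∩ s').indicator (fun _ => (1 : ℂ)) p ∂spaceTimeMeasure d T)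
        * (A.mean (star f' * f) * if k - k' = 0 then 1 else 0) := by
  rw [L2.inner_def, A.mean_eq_integral, ← integral_mFourier,
    ← integral_prod_mul (μ := A.meanMeasure) (ν := (volume : Measure (UnitAddTorus (Fin d))))
      (fun s => WeakDual.gelfandTransform ℂ A.Alg (star f' * f) s)
      (fun y => UnitAddTorus.mFourier (k - k') y),
    ← integral_prod_mul]
  refine integral_congr_ae ?_
  filter_upwards [coeFn_gelfandOp_toLp (memLp_indicator_const 2 hs
      (A.tensor f (UnitAddTorus.mFourier k)) (Or.inr hsf)),
    coeFn_gelfandOp_toLp (memLp_indicator_const 2 hs'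
      (A.tensor f' (UnitAddTorus.mFourier k')) (Or.inr hsf'))] with q h1 h2
  simp only [indicatorConstLp]
  rw [h1, h2]
  refine (indicator_mul_indicator_const s s' _ _ (A.gelfandEval q.2) q.1).trans ?_
  simp only [A.gelfandEval_apply, A.gelfandHat_tensor]
  congr 1
  rw [← conj_mFourier_mul, map_mul]
  change _ = q.2.1 (star f' * f) * _
  rw [A.apply_star_mul]
  ring

/-- A is closed under products and conjugation, and characters multiply to characters, so one
oscillating factor remains. -/
theorem inner_traceOp_indicator (hΦ : IsAdmissibleFlow Φ) (ε : ℝ)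
    {s s' : Set (ℝ × Space d)} (hs : MeasurableSet s)
    (hs' : MeasurableSet s') (hsf : spaceTimeMeasure d T s ≠ ⊤)
    (hsf' : spaceTimeMeasure d T s' ≠ ⊤) (f f' : A.Alg) (k k' : Fin d → ℤ) :
    inner ℂ
        (traceOp A T hΦ ε (indicatorConstLp 2 hs' hsf' (A.tensor f' (UnitAddTorus.mFourier k'))))
        (traceOp A T hΦ ε (indicatorConstLp 2 hs hsf (A.tensor f (UnitAddTorus.mFourier k))))
      = ∫ p, (s ∩ s').indicator (fun _ => (1 : ℂ)) (flowPullback Φ ε p)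
          * oscillatingFactor (star f' * f) (k - k') ε p ∂spaceTimeMeasure d T := by
  rw [L2.inner_def]
  refine integral_congr_ae ?_
  filter_upwards [coeFn_traceOp_toLp hΦ ε (memLp_indicator_const 2 hs
      (A.tensor f (UnitAddTorus.mFourier k)) (Or.inr hsf)),
    coeFn_traceOp_toLp hΦ ε (memLp_indicator_const 2 hs'
      (A.tensor f' (UnitAddTorus.mFourier k')) (Or.inr hsf'))] with p h1 h2
  simp only [indicatorConstLp]
  rw [h1, h2]
  refine (indicator_mul_indicator_const s s' _ _ (A.rescaledEval ε p) (flowPullback Φ ε p)).trans ?_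
  simp only [A.rescaledEval_apply, A.tensor_apply, oscillatingFactor]
  congr 1
  rw [← conj_mFourier_mul, map_mul]
  change _ = (starRingEnd ℂ) (f'.1 (p.1 / ε)) * f.1 (p.1 / ε) * _
  ring

/-- The functions `1_s(t, X) f(τ) e_k(y)` lie in no proper closed subspace. -/
theorem eq_top_of_indicator_tensor_mem
    {V : Submodule ℂ (Lp (A.productAlgebra d) 2 (spaceTimeMeasure d T))}
    (hV : IsClosed (V : Set (Lp (A.productAlgebra d) 2 (spaceTimeMeasure d T))))
    (h : ∀ (s : Set (ℝ × Space d)) (hs : MeasurableSet s) (hsf : spaceTimeMeasure d T s ≠ ⊤)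
      (f : A.Alg) (k : Fin d → ℤ),
      indicatorConstLp 2 hs hsf (A.tensor f (UnitAddTorus.mFourier k)) ∈ V) : V = ⊤ := by
  rw [eq_top_iff]
  rintro ψ -
  refine Lp.induction ENNReal.ofNat_ne_top (motive := fun ψ => ψ ∈ V) ?_ ?_ hV ψ
  · intro F s hs hsf
    rw [Lp.simpleFunc.coe_indicatorConst]
    -- Since F ↦ 1_s F is linear and continuous, the admissible values F form a closed subspace, to
    -- which density in A ⊙ C(𝕋^d) applies.
    let I : A.productAlgebra d →L[ℂ] Lp (A.productAlgebra d) 2 (spaceTimeMeasure d T) :=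
      LinearMap.mkContinuous
        { toFun := fun F => indicatorConstLp 2 hs hsf.ne F
          map_add' := fun F G => by
            simp only [indicatorConstLp, ← MemLp.toLp_add]
            refine MemLp.toLp_congr _ _ (Eventually.of_forall fun p => ?_)
            exact congrFun (indicator_add s (fun _ => F) (fun _ => G)) p
          map_smul' := fun c F => by
            simp only [indicatorConstLp, RingHom.id_apply, ← MemLp.toLp_const_smul]
            refine MemLp.toLp_congr _ _ (Eventually.of_forall fun p => ?_)
            exact congrFun (indicator_const_smul s c (fun _ => F)) p }
        ((spaceTimeMeasure d T).real s ^ (1 / (2 : ENNReal).toReal)) fun F => by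
          rw [mul_comm]
          exact norm_indicatorConstLp_le (hs := hs) (hμs := hsf.ne)
    have htop : V.comap (I : A.productAlgebra d →ₗ[ℂ] _) = ⊤ :=
      A.eq_top_of_tensor_mFourier_mem (hV.preimage I.continuous) fun f k => h s hs hsf.ne f k
    have hF : F ∈ V.comap (I : A.productAlgebra d →ₗ[ℂ] _) := by rw [htop]; trivial
    exact hF
  · exact fun f g hf hg _ hfV hgV => V.add_mem hfV hgV

theorem tendsto_inner_traceOp (hΦ : IsAdmissibleFlow Φ) {ε : ℕ → ℝ}
    (hε : Tendsto ε atTop (𝓝[>] 0))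
    (φ ψ : Lp (A.productAlgebra d) 2 (spaceTimeMeasure d T)) :
    Tendsto (fun n => inner ℂ (traceOp A T hΦ (ε n) φ) (traceOp A T hΦ (ε n) ψ)) atTop
      (𝓝 (inner ℂ (gelfandOp A T φ) (gelfandOp A T ψ))) := by
  refine tendsto_inner_of_generators (gelfandOp A T) (fun n => traceOp A T hΦ (ε n))
    (fun n => norm_evalOp_le _ _ _)
    {ψ | ∃ (s : Set (ℝ × Space d)) (hs : MeasurableSet s) (hsf : spaceTimeMeasure d T s ≠ ⊤)
      (f : A.Alg) (k : Fin d → ℤ),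
      ψ = indicatorConstLp 2 hs hsf (A.tensor f (UnitAddTorus.mFourier k))} ?_ ?_ φ ψ
  · exact fun V hV hG => eq_top_of_indicator_tensor_mem hV fun s hs hsf f k =>
      hG ⟨s, hs, hsf, f, k, rfl⟩
  · rintro _ ⟨s', hs', hsf', f', k', rfl⟩ _ ⟨s, hs, hsf, f, k, rfl⟩
    simp only [inner_traceOp_indicator, inner_gelfandOp_indicator]
    have hw : Integrable ((s ∩ s').indicator fun _ => (1 : ℂ)) (spaceTimeMeasure d T) :=
      (integrable_indicator_iff (hs.inter hs')).2
        (integrableOn_const (measure_ne_top_of_subset inter_subset_left hsf))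
    exact (hΦ.tendsto_integral_mul_oscillatingFactor_ite (star f' * f) (k - k') hw).comp hε

theorem tendsto_norm_traceOp (hΦ : IsAdmissibleFlow Φ) {ε : ℕ → ℝ}
    (hε : Tendsto ε atTop (𝓝[>] 0)) (ψ : Lp (A.productAlgebra d) 2 (spaceTimeMeasure d T)) :
    Tendsto (fun n => ‖traceOp A T hΦ (ε n) ψ‖) atTop (𝓝 ‖gelfandOp A T ψ‖) := by
  have h := (Complex.continuous_re.tendsto _).comp (tendsto_inner_traceOp hΦ hε ψ ψ)
  have h2 := (Real.continuous_sqrt.tendsto _).comp h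
  simpa only [Function.comp_def, ← RCLike.re_eq_complex_re, ← norm_eq_sqrt_re_inner] using h2

end Operators

/-! ### Conclusion -/

theorem norm_star_le_norm {Z : Type*} [MeasurableSpace Z] {ν : Measure Z} (u : Lp ℂ 2 ν) :
    ‖star u‖ ≤ ‖u‖ := by
  refine Lp.norm_le_norm_of_ae_le ?_
  filter_upwards [Lp.coeFn_star u] with z hz
  rw [hz, Pi.star_apply, norm_star]

/-- The inner product conjugates its first slot, whereas Σ-convergence uses the bilinear pairing;
`star` reconciles the two. -/
theorem inner_star_eq_integral {Z : Type*} [MeasurableSpace Z] {ν : Measure Z} (u v : Lp ℂ 2 ν)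
    {g : Z → ℂ} (hg : v =ᵐ[ν] g) : inner ℂ (star u) v = ∫ z, u z * g z ∂ν := by
  rw [L2.inner_def]
  refine integral_congr_ae ?_
  filter_upwards [hg, Lp.coeFn_star u] with z h1 h2
  rw [h1, h2]
  simp [mul_comm]

theorem mainTheorem2 (A : AlgebraWithMeanValue) (d : ℕ) (T : ℝ) (hT : 0 < T)
    (Φ : ℝ → Space d → Space d) (hΦ : IsAdmissibleFlow Φ)
    (ε : ℕ → ℝ) (hε : ∀ n, 0 < ε n) (hε₀ : Tendsto ε atTop (𝓝 0))
    (u : ℕ → Lp ℂ 2 (spaceTimeMeasure d T)) (hu : ∃ C : ℝ, ∀ n, ‖u n‖ ≤ C) :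
    ∃ k : ℕ → ℕ, StrictMono k ∧ ∃ u₀ : Lp ℂ 2 (limitMeasure A d T),
      WeaklySigmaConverges A T Φ (ε ∘ k) (u ∘ k) u₀ := by
  obtain ⟨C, hC⟩ := hu
  have hε' : Tendsto ε atTop (𝓝[>] 0) :=
    tendsto_nhdsWithin_iff.2 ⟨hε₀, Eventually.of_forall hε⟩
  obtain ⟨k, hk, w, hw⟩ := exists_subseq_tendsto_inner
    (gelfandOp A (d := d) T).toLinearMap
    (fun n => (traceOp A T hΦ (ε n)).toLinearMap)
    (tendsto_norm_traceOp hΦ hε') (fun n => star (u n)) (C := C)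
    (fun n => (norm_star_le_norm (u n)).trans (hC n))
  refine ⟨k, hk, star w, fun ψ hψ => ?_⟩
  have h := hw hψ.memLp.toLp
  have h1 := inner_star_eq_integral (star w) _ (coeFn_gelfandOp_toLp hψ.memLp)
  rw [star_star] at h1
  rw [← h1]
  refine h.congr fun n => ?_
  exact inner_star_eq_integral _ _ (coeFn_traceOp_toLp hΦ _ hψ.memLp)
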